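/- Let $n,r\ge 1$. There are $n$ prisoners and $r$ indistinguishable rooms, each room being in one of $q\ge 1$ states $0,1,\dots,q-1$; the initial states of the rooms are known to the prisoners. A warden leads the prisoners one at a time into rooms according to a schedule, unknown to them, in which every prisoner visits every room infinitely often. On each visit a prisoner sees the current state of the room, may change it, and may declare that all prisoners have visited all rooms; these decisions are a deterministic function of the sequence of states that this prisoner has seen so far (including the current one). A strategy is winning if, for every such schedule, some prisoner eventually declares, and whenever a prisoner declares, every prisoner has already visited every room. It is symmetric if all prisoners use the same function. (i) Suppose all rooms start in state $0$. Then the $n$ prisoners have a symmetric winning strategy for $r$ rooms with $q$ states for some $q$ if and only if $\gcd(n,r)=1$. (ii) There is a function $f:\mathbb{N}\to\mathbb{N}$ such that whenever $\gcd(n,r)=1$, a symmetric winning strategy exists for every $q\ge f(\min(n,r))$ when all rooms start in state $0$, and for every $q\ge f(\min(n,r))+r-1$ when the rooms start in an arbitrary known configuration of states. (iii) If $\gcd(n,r)=1$ and all rooms start in state $0$, then a symmetric winning strategy exists for every $q\ge 2n+4$ when $r>n$, and for every $q\ge 8r-4$ when $n>r$. -/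

import Mathlib

/-- A deterministic protocol for one prisoner, when every room has `q` possible states.
A prisoner only ever learns the states in which they find the rooms they are led into, so on each
visit everything the protocol may use is the list of states found so far, *most recent first*; its
head is the state of the room being visited. (The states in which the prisoner left the rooms are
determined by this list and the protocol itself.) -/
structure Protocol (q : ℕ) where
  /-- The state in which the prisoner leaves the room they are visiting. -/
  next : List (Fin q) → Fin q
  /-- Whether, on this visit, the prisoner claims that all prisoners have visited all rooms. -/
  declares : List (Fin q) → Prop

/-- A schedule of the warden: at each time, which prisoner is led into which room. -/
abbrev Schedule (n r : ℕ) : Type := ℕ → Fin n × Fin r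

/-- A schedule is valid if every prisoner visits every room arbitrarily many times. -/
def Schedule.Valid {n r : ℕ} (s : Schedule n r) : Prop :=
  ∀ (i : Fin n) (j : Fin r) (T : ℕ), ∃ t, T ≤ t ∧ s t = (i, j)

/-- The global situation: the state of each room, and the list of the states that each prisoner
has found so far (most recent first). -/
structure Config (n r q : ℕ) where
  room : Fin r → Fin q
  seen : Fin n → List (Fin q)

/-- The effect of leading prisoner `v.1` into room `v.2`. -/
def Config.visit {n r q : ℕ} (S : Fin n → Protocol q) (c : Config n r q) (v : Fin n × Fin r) :
    Config n r q where
  room := Function.update c.room v.2 ((S v.1).next (c.room v.2 :: c.seen v.1))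
  seen := Function.update c.seen v.1 (c.room v.2 :: c.seen v.1)

/-- The situation just before the visit at time `t`, when prisoner `i` follows the protocol `S i`
and the rooms are initially in the states `init`. -/
def run {n r q : ℕ} (S : Fin n → Protocol q) (init : Fin r → Fin q) (s : Schedule n r) :
    ℕ → Config n r q
  | 0 => ⟨init, fun _ => []⟩
  | t + 1 => (run S init s t).visit S (s t)

/-- The prisoner who makes the visit at time `t` declares on that visit. -/
def DeclaresAt {n r q : ℕ} (S : Fin n → Protocol q) (init : Fin r → Fin q) (s : Schedule n r)
    (t : ℕ) : Prop :=
  (S (s t).1).declares ((run S init s (t + 1)).seen (s t).1)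

/-- The protocols `S i`, one for each of the `n` prisoners, form a winning strategy for `r` rooms
with `q` states that are initially in the states `init`: for every valid schedule some prisoner
eventually declares, and whenever a prisoner declares, every prisoner has visited every room. -/
def IsWinning {n r q : ℕ} (S : Fin n → Protocol q) (init : Fin r → Fin q) : Prop :=
  ∀ s : Schedule n r, s.Valid →
    (∃ t, DeclaresAt S init s t) ∧
      ∀ t, DeclaresAt S init s t → ∀ (i : Fin n) (j : Fin r), ∃ u, u ≤ t ∧ s u = (i, j)

/-- The `n` prisoners have a symmetric winning strategy (all of them follow the same protocol) for
`r` rooms with `q` states, when the rooms are known to be initially in the states `init`. -/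
def HasSymmetricWinningStrategy (n r q : ℕ) (init : Fin r → Fin q) : Prop :=
  ∃ P : Protocol q, IsWinning (fun _ : Fin n => P) init

/-- All `r` rooms are in state `0`. -/
def allZero (r : ℕ) {q : ℕ} (hq : 0 < q) : Fin r → Fin q := fun _ => ⟨0, hq⟩

/-!
**Impossibility.** Let `d > 1` divide both numbers. Divide prisoners and rooms into `d` groups each,
and let the warden proceed in blocks of `d` visits that treat all groups alike, up to a cyclic shift
`κ` of the groups of rooms against the groups of prisoners. Symmetric prisoners then see what a
single group of prisoners sees in a single group of rooms (`run_blockSchedule`), whatever the shifts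
are; so they declare at the same time even if no shift has been used until then and no prisoner has
left the rooms of his own group.

**Election of a leader.** Every prisoner initially holds an integer amount `u` and every room an
amount `v` with `n * u + r * v = 0`; besides, a total weight `m`, which is the number of prisoners
or the number of rooms, is distributed over the prisoners (one unit each) or over the rooms (one
unit each). The amounts are chosen such that modulo `m` they are the `w`-fold of the weights for
some `w` coprime to `m`: this is where coprimality of the two numbers enters. The first visitor of a
room takes its whole amount. In all other visits, a prisoner in debt (with a negative amount) merges
his amount with that of the room, a positive sum staying in the room and any other sum with him; a
prisoner with a positive amount gives it away in portions of `m`, to empty rooms. So, after its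
first visit, a room only ever holds an amount between `0` and `m`. Weights move along with the
residues modulo `m`, so that an amount is divisible by `m` if and only if its weight is `0` or `m`.
Hence, when two amounts that are not divisible by `m` merge to one that is, all the weight has come
together (`Electing.elected`). The prisoner who observes this becomes leader, and all amounts
elsewhere are multiples of `m`, so that there is no second leader. (For `m = 1` there is only one
prisoner or only one room, and the first prisoner to enter a room becomes leader.) If no leader were
ever elected, the process would come to rest (`exists_stuck`); at rest there cannot be both negative
and positive amounts, so all amounts are `0`, hence all weights are `0`, which is absurd
(`Electing.not_stuck`).

**Verification by the leader.** The leader changes all rooms to `ready`, except for the last one,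
which gets the `token`. Another prisoner takes the token and changes `r` rooms from `ready` (or
`token`) to `touched`, thus visiting all rooms; the leader learns this by changing `r` rooms from
`touched` to `counted`. This is repeated with the next prisoner. After `n - 1` such tours the leader
makes all rooms ready once more and declares.

There are `m + 2` states for the election, of which only the blank one is needed when `m = 1`, and
four marks, of which `ready` is not needed when `r = 1`. For an arbitrary known initial
configuration, all states that occur in it are read as the blank one.
-/

/-! ### Protocols given by machines -/

/-- A Mealy machine, possibly with infinitely many memories, followed by every prisoner: `H` is the
type of memories of a prisoner, `σ` the type of states of a room, `start` the memory of a prisoner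
before the first visit and `blank` the initial state of every room. -/
structure Machine (H σ : Type) where
  start : H
  blank : σ
  step : H → σ → H × σ
  /-- The memories in which a prisoner declares. -/
  final : H → Prop

namespace Machine

variable {H σ : Type} {n r q : ℕ}

/-- The memory of a prisoner who has found the given states (most recent first), when the states
of the rooms are read through `dec`. -/
def memory (M : Machine H σ) (dec : Fin q → σ) : List (Fin q) → H
  | [] => M.start
  | x :: l => (M.step (M.memory dec l) (dec x)).1

/-- The protocol that follows the machine `M`, writing states through `enc` and reading them
through `dec`. The value of `next` at the empty list is never used. -/
def toProtocol (M : Machine H σ) (dec : Fin q → σ) (enc : σ → Fin q) : Protocol q where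
  next
    | [] => enc M.blank
    | x :: l => enc (M.step (M.memory dec l) (dec x)).2
  declares l := M.final (M.memory dec l)

/-- The effect of a visit on the memories of the prisoners and the states of the rooms. -/
def visit (M : Machine H σ) (c : (Fin n → H) × (Fin r → σ)) (i : Fin n) (j : Fin r) :
    (Fin n → H) × (Fin r → σ) :=
  (Function.update c.1 i (M.step (c.1 i) (c.2 j)).1,
    Function.update c.2 j (M.step (c.1 i) (c.2 j)).2)

/-- The memories and the states of the rooms just before the visit at time `t`. -/
def trace (M : Machine H σ) (s : Schedule n r) : ℕ → (Fin n → H) × (Fin r → σ)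
  | 0 => (fun _ => M.start, fun _ => M.blank)
  | t + 1 => M.visit (M.trace s t) (s t).1 (s t).2

/-- Following `M` is a winning strategy for `n` prisoners and `r` rooms that are all initially
in the state `M.blank`. -/
def Wins (M : Machine H σ) (n r : ℕ) : Prop :=
  ∀ s : Schedule n r, s.Valid →
    (∃ t, M.final ((M.trace s (t + 1)).1 (s t).1)) ∧
      ∀ t, M.final ((M.trace s (t + 1)).1 (s t).1) →
        ∀ (i : Fin n) (j : Fin r), ∃ u, u ≤ t ∧ s u = (i, j)

theorem run_toProtocol (M : Machine H σ) (good : σ → Prop) (hblank : good M.blank)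
    (hstep : ∀ p x, good x → good (M.step p x).2) (dec : Fin q → σ) (enc : σ → Fin q)
    (hdec : ∀ x, good x → dec (enc x) = x) (init : Fin r → Fin q)
    (hinit : ∀ j, dec (init j) = M.blank) (s : Schedule n r) (t : ℕ) :
    (∀ i, M.memory dec ((run (fun _ => M.toProtocol dec enc) init s t).seen i)
        = (M.trace s t).1 i) ∧
      (∀ j, dec ((run (fun _ => M.toProtocol dec enc) init s t).room j) = (M.trace s t).2 j) ∧
      ∀ j, good ((M.trace s t).2 j) := by
  induction t with
  | zero => exact ⟨fun _ => rfl, hinit, fun _ => hblank⟩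
  | succ t ih =>
    obtain ⟨h1, h2, h3⟩ := ih
    refine ⟨fun i => ?_, fun j => ?_, fun j => ?_⟩
    · simp only [run, trace, Config.visit, visit]
      by_cases hi : i = (s t).1
      · subst hi
        simp only [Function.update_self, memory, h1, h2]
      · simp only [Function.update_of_ne hi, h1]
    · simp only [run, trace, Config.visit, visit]
      by_cases hj : j = (s t).2
      · subst hj
        rw [Function.update_self, Function.update_self, ← h1, ← h2]
        exact hdec _ (hstep _ _ (h2 _ ▸ h3 _))
      · simp only [Function.update_of_ne hj, h2]
    · simp only [trace, visit]
      by_cases hj : j = (s t).2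
      · subst hj
        simp only [Function.update_self]
        exact hstep _ _ (h3 _)
      · simp only [Function.update_of_ne hj, h3]

/-- A winning machine that uses at most `g` states of the rooms yields a winning strategy with `q`
states from a known initial configuration: all states that occur initially are read as blank, so
that only the `g - 1` other states need codes outside the initial ones. -/
theorem Wins.hasSymmetricWinningStrategy {M : Machine H σ} (hM : M.Wins n r) (hr : 0 < r)
    (good : σ → Prop) (hblank : good M.blank)
    (hstep : ∀ p x, good x → good (M.step p x).2) (code : σ → ℕ) (g : ℕ)
    (hinj : ∀ x y, good x → good y → code x = code y → x = y) (hcode : ∀ x, good x → code x < g)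
    (hzero : code M.blank = 0) (init : Fin r → Fin q)
    (hg : g + (Finset.univ.image init).card ≤ q + 1) :
    HasSymmetricWinningStrategy n r q init := by
  classical
  set I := Finset.univ.image init with hI
  have hinitI : ∀ j, init j ∈ I := fun j => Finset.mem_image_of_mem _ (Finset.mem_univ j)
  have hcard : Fintype.card (Fin (g - 1)) ≤ Fintype.card {y // y ∉ I} := by
    rw [Fintype.card_fin, Fintype.card_subtype_compl, Fintype.card_fin, Fintype.card_coe]
    omega
  obtain ⟨emb⟩ := Function.Embedding.nonempty_of_card_le hcard
  let enc : σ → Fin q := fun x =>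
    if h : code x ≠ 0 ∧ code x < g then emb ⟨code x - 1, by omega⟩ else init ⟨0, hr⟩
  let dec : Fin q → σ := fun y =>
    if h : ∃ x, good x ∧ code x ≠ 0 ∧ enc x = y then h.choose else M.blank
  have henc : ∀ x, good x → code x ≠ 0 →
      ∃ h : code x - 1 < g - 1, enc x = emb ⟨code x - 1, h⟩ := by
    intro x hx h0
    have := hcode x hx
    exact ⟨by omega, by simp only [enc]; rw [dif_pos ⟨h0, this⟩]⟩
  have hencI : ∀ x, good x → code x ≠ 0 → enc x ∉ I := by
    intro x hx h0
    obtain ⟨h, e⟩ := henc x hx h0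
    rw [e]
    exact (emb _).2
  have hdecI : ∀ y ∈ I, dec y = M.blank := by
    intro y hy
    simp only [dec]
    rw [dif_neg]
    rintro ⟨x, hx, h0, rfl⟩
    exact hencI x hx h0 hy
  have hdec : ∀ x, good x → dec (enc x) = x := by
    intro x hx
    by_cases h0 : code x = 0
    · have hxb : x = M.blank := hinj _ _ hx hblank (h0.trans hzero.symm)
      have : enc x = init ⟨0, hr⟩ := by simp [enc, h0]
      rw [this, hdecI _ (hinitI _), hxb]
    · have hex : ∃ x', good x' ∧ code x' ≠ 0 ∧ enc x' = enc x := ⟨x, hx, h0, rfl⟩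
      have hd : dec (enc x) = hex.choose := by simp only [dec]; rw [dif_pos hex]
      obtain ⟨hg', h0', he⟩ := hex.choose_spec
      rw [hd]
      obtain ⟨l1, e1⟩ := henc _ hg' h0'
      obtain ⟨l2, e2⟩ := henc _ hx h0
      have := emb.injective (Subtype.ext (e1.symm.trans (he.trans e2)))
      simp only [Fin.mk.injEq] at this
      exact hinj _ _ hg' hx (by omega)
  refine ⟨M.toProtocol dec enc, fun s hs => ?_⟩
  have hD : ∀ t, DeclaresAt (fun _ : Fin n => M.toProtocol dec enc) init s t ↔
      M.final ((M.trace s (t + 1)).1 (s t).1) := by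
    intro t
    rw [← (M.run_toProtocol good hblank hstep dec enc hdec init
      (fun j => hdecI _ (hinitI j)) s (t + 1)).1]
    rfl
  simpa only [hD] using hM s hs

end Machine

/-! ### Impossibility when the numbers are not coprime -/

section Impossibility

/-- A sequence in a finite nonempty type that takes every value infinitely often. -/
theorem exists_seq_frequently (X : Type) [Finite X] [Nonempty X] :
    ∃ f : ℕ → X, ∀ x T, ∃ t, T ≤ t ∧ f t = x := by
  have := Fintype.ofFinite X
  have e := Fintype.equivFin X
  have hN : 0 < Fintype.card X := Fintype.card_pos
  refine ⟨fun t => e.symm ⟨t % Fintype.card X, Nat.mod_lt _ hN⟩, fun x T => ?_⟩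
  refine ⟨T * Fintype.card X + e x, ?_, ?_⟩
  · have := Nat.le_mul_of_pos_right T hN
    omega
  · rw [Equiv.symm_apply_eq]
    ext
    simp [Nat.mod_eq_of_lt (e x).2]

variable {d a b q : ℕ} [NeZero d]

/-- The schedule of `d * a` prisoners and `d * b` rooms, both divided into `d` groups, in which the
`k`-th block of `d` visits leads one prisoner of each group `g` into a room of the group
`g + κ k`; the places within the groups are given by `σ k`. -/
def blockSchedule (κ : ℕ → Fin d) (σ : Schedule a b) : Schedule (d * a) (d * b) := fun t =>
  (finProdFinEquiv (Fin.ofNat d t, (σ (t / d)).1),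
    finProdFinEquiv (Fin.ofNat d t + κ (t / d), (σ (t / d)).2))

/-- In the course of the `k`-th block, the prisoners and rooms that have had their visit are as
after step `k` of the run of `a` prisoners and `b` rooms, and the others are as before it. -/
theorem run_blockSchedule (P : Protocol q) (x : Fin q) (κ : ℕ → Fin d) (σ : Schedule a b)
    (k g : ℕ) (hg : g ≤ d) :
    (∀ g' i, (run (fun _ => P) (fun _ => x) (blockSchedule κ σ) (d * k + g)).seen
        (finProdFinEquiv (g', i)) =
      (run (fun _ => P) (fun _ => x) σ (if g'.1 < g then k + 1 else k)).seen i) ∧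
    (∀ g' j, (run (fun _ => P) (fun _ => x) (blockSchedule κ σ) (d * k + g)).room
        (finProdFinEquiv (g' + κ k, j)) =
      (run (fun _ => P) (fun _ => x) σ (if g'.1 < g then k + 1 else k)).room j) := by
  have block : ∀ k,
      (∀ g' i, (run (fun _ => P) (fun _ => x) (blockSchedule κ σ) (d * k)).seen
        (finProdFinEquiv (g', i)) = (run (fun _ => P) (fun _ => x) σ k).seen i) →
      (∀ g' j, (run (fun _ => P) (fun _ => x) (blockSchedule κ σ) (d * k)).room
        (finProdFinEquiv (g' + κ k, j)) = (run (fun _ => P) (fun _ => x) σ k).room j) →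
      ∀ g ≤ d,
      (∀ g' i, (run (fun _ => P) (fun _ => x) (blockSchedule κ σ) (d * k + g)).seen
        (finProdFinEquiv (g', i)) =
      (run (fun _ => P) (fun _ => x) σ (if g'.1 < g then k + 1 else k)).seen i) ∧
    (∀ g' j, (run (fun _ => P) (fun _ => x) (blockSchedule κ σ) (d * k + g)).room
        (finProdFinEquiv (g' + κ k, j)) =
      (run (fun _ => P) (fun _ => x) σ (if g'.1 < g then k + 1 else k)).room j) := by
    intro k h1 h2 g hg
    induction g with
    | zero => exact ⟨by simpa using h1, by simpa using h2⟩
    | succ g ih =>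
      obtain ⟨ih1, ih2⟩ := ih (by omega)
      have hd : (d * k + g) / d = k := by
        rw [Nat.mul_add_div (by omega), Nat.div_eq_of_lt (by omega), add_zero]
      have hm : Fin.ofNat d (d * k + g) = ⟨g, by omega⟩ := by
        ext
        simp [Nat.mod_eq_of_lt (show g < d by omega)]
      have hs : blockSchedule κ σ (d * k + g) = (finProdFinEquiv (⟨g, by omega⟩, (σ k).1),
          finProdFinEquiv (⟨g, by omega⟩ + κ k, (σ k).2)) := by
        simp only [blockSchedule, hd, hm]
      have e1 := ih1 ⟨g, by omega⟩ (σ k).1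
      have e2 := ih2 ⟨g, by omega⟩ (σ k).2
      simp only [lt_irrefl, if_false] at e1 e2
      have ne : ∀ g' : Fin d, g' ≠ ⟨g, by omega⟩ → (g'.1 < g + 1 ↔ g'.1 < g) := by
        intro g' h
        have : g'.1 ≠ g := fun h' => h (Fin.ext h')
        omega
      refine ⟨fun g' i => ?_, fun g' j => ?_⟩
      · rw [← add_assoc, run, Config.visit, hs]
        simp only [e1, e2]
        by_cases hg' : g' = ⟨g, by omega⟩
        · subst hg'
          by_cases hi : i = (σ k).1
          · subst hi
            simp [run, Config.visit]
          · rw [Function.update_of_ne (by simpa using hi), ih1]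
            simp [run, Config.visit, hi]
        · rw [Function.update_of_ne (by simp [hg']), ih1]
          simp only [ne g' hg']
      · rw [← add_assoc, run, Config.visit, hs]
        simp only [e1, e2]
        by_cases hg' : g' = ⟨g, by omega⟩
        · subst hg'
          by_cases hi : j = (σ k).2
          · subst hi
            simp [run, Config.visit]
          · rw [Function.update_of_ne (by simpa using hi), ih2]
            simp [run, Config.visit, hi]
        · rw [Function.update_of_ne (by simp [hg']), ih2]
          simp only [ne g' hg']
  have start : ∀ k,
      (∀ g' i, (run (fun _ => P) (fun _ => x) (blockSchedule κ σ) (d * k)).seen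
        (finProdFinEquiv (g', i)) = (run (fun _ => P) (fun _ => x) σ k).seen i) ∧
      (∀ g' j, (run (fun _ => P) (fun _ => x) (blockSchedule κ σ) (d * k)).room
        (finProdFinEquiv (g', j)) = (run (fun _ => P) (fun _ => x) σ k).room j) := by
    intro k
    induction k with
    | zero => exact ⟨fun _ _ => rfl, fun _ _ => rfl⟩
    | succ k ih =>
      obtain ⟨h1, h2⟩ := block k ih.1 (fun g' j => ih.2 _ _) d le_rfl
      refine ⟨fun g' i => ?_, fun g' j => ?_⟩
      · simpa [Nat.mul_succ] using h1 g' i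
      · simpa [Nat.mul_succ] using h2 (g' - κ k) j
  exact block k (start k).1 (fun g' j => (start k).2 _ _) g hg

theorem declaresAt_blockSchedule (P : Protocol q) (x : Fin q) (κ : ℕ → Fin d) (σ : Schedule a b)
    (t : ℕ) : DeclaresAt (fun _ => P) (fun _ => x) (blockSchedule κ σ) t ↔
      P.declares ((run (fun _ => P) (fun _ => x) σ (t / d + 1)).seen (σ (t / d)).1) := by
  have hd : 0 < d := Nat.pos_of_neZero d
  have h := (run_blockSchedule P x κ σ (t / d) (t % d + 1) (Nat.mod_lt t hd)).1
    (Fin.ofNat d t) (σ (t / d)).1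
  rw [← add_assoc, Nat.div_add_mod, if_pos (by simp)] at h
  rw [DeclaresAt, ← h]
  rfl

/-- Whether and when a prisoner declares under a block schedule does not depend on the pairing `κ`
of the groups. With the constant pairing up to the moment of declaration, a prisoner of the group
`0` has not been in any room of the group `1`. -/
theorem gcd_eq_one_of_hasSymmetricWinningStrategy {n r q : ℕ} (hn : 0 < n) (hr : 0 < r)
    (x : Fin q) (h : HasSymmetricWinningStrategy n r q (fun _ => x)) : Nat.gcd n r = 1 := by
  by_contra hne
  obtain ⟨a, ha⟩ := Nat.gcd_dvd_left n r
  obtain ⟨b, hb⟩ := Nat.gcd_dvd_right n r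
  have hd0 : 0 < Nat.gcd n r := Nat.gcd_pos_of_pos_left _ hn
  generalize Nat.gcd n r = d at *
  subst ha hb
  have : NeZero d := ⟨hd0.ne'⟩
  have ha : 0 < a := Nat.pos_of_mul_pos_left hn
  have hb : 0 < b := Nat.pos_of_mul_pos_left hr
  obtain ⟨P, hP⟩ := h
  have : Nonempty (Fin d × Fin a × Fin b) := ⟨⟨0, hd0⟩, ⟨0, ha⟩, ⟨0, hb⟩⟩
  obtain ⟨f, hf⟩ := exists_seq_frequently (Fin d × Fin a × Fin b)
  have valid : ∀ (κ : ℕ → Fin d) (T₀ : ℕ), (∀ k, T₀ ≤ k → κ k = (f k).1) →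
      (blockSchedule κ fun k => (f k).2).Valid := by
    intro κ T₀ hκ i j T
    obtain ⟨⟨g, i⟩, rfl⟩ := finProdFinEquiv.surjective i
    obtain ⟨⟨g', j⟩, rfl⟩ := finProdFinEquiv.surjective j
    obtain ⟨k, hk, hfk⟩ := hf (g' - g, i, j) (max T₀ T)
    have h1 : (d * k + g) / d = k := by
      rw [Nat.mul_add_div hd0, Nat.div_eq_of_lt g.2, add_zero]
    have h2 : Fin.ofNat d (d * k + g) = g := by
      ext
      simp [Nat.mod_eq_of_lt g.2]
    refine ⟨d * k + g, ?_, ?_⟩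
    · have := Nat.le_mul_of_pos_left k hd0
      omega
    · simp only [blockSchedule, h1, h2, hκ k (by omega), hfk, add_sub_cancel]
  obtain ⟨t, ht⟩ := (hP _ (valid (fun k => (f k).1) 0 fun _ _ => rfl)).1
  rw [declaresAt_blockSchedule] at ht
  have hlate := (hP _ (valid (fun k => if k ≤ t / d then 0 else (f k).1) (t / d + 1)
    fun k hk => if_neg (by omega))).2 t ((declaresAt_blockSchedule _ _ _ _ _).2 ht)
  obtain ⟨u, hu, hv⟩ := hlate (finProdFinEquiv (0, ⟨0, ha⟩))
    (finProdFinEquiv (⟨1, by omega⟩, ⟨0, hb⟩))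
  simp only [blockSchedule, if_pos (Nat.div_le_div_right (c := d) hu), Prod.mk.injEq,
    EmbeddingLike.apply_eq_iff_eq, add_zero] at hv
  have := congrArg Fin.val (hv.1.1.symm.trans hv.2.1)
  simp at this

end Impossibility

/-! ### The protocol -/

/-- What a prisoner remembers. -/
inductive Memory where
  /-- The prisoner takes part in the election of a leader and holds the amount `h`. -/
  | elect (h : ℤ)
  /-- The prisoner has taken the token and has since touched `e` rooms; the tour is over when `e`
  is the number of rooms. -/
  | active (e : ℕ)
  /-- The leader, after `d` completed tours of other prisoners, has made `k` rooms ready. -/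
  | post (d k : ℕ)
  /-- The leader, after `d` completed tours of other prisoners, has counted `k` rooms of the
  next tour. -/
  | collect (d k : ℕ)
  /-- The leader knows that all prisoners have visited all rooms. -/
  | done

/-- The states of a room: its initial state, an amount deposited during the election, and four
marks that are used after the election. -/
inductive RoomState where
  | blank
  | val (x : ℤ)
  | ready
  | token
  | touched
  | counted

/-- The amount held by a prisoner; it is `0` for those who have left the election. -/
def Memory.value : Memory → ℤ
  | .elect h => h
  | _ => 0

/-- The amount in a room, where a blank room is worth `v`. -/
def RoomState.value (v : ℤ) : RoomState → ℤ
  | .blank => v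
  | .val x => x
  | _ => 0

/-- The room has been visited by the leader after the election. -/
def RoomState.Marked : RoomState → Prop
  | .blank => False
  | .val _ => False
  | _ => True

/-- The indicator of active prisoners. -/
def Memory.activeCount : Memory → ℕ
  | .active _ => 1
  | _ => 0

/-- The indicator of ready rooms. -/
def RoomState.readyCount : RoomState → ℕ
  | .ready => 1
  | _ => 0

/-- The indicator of counted rooms. -/
def RoomState.countedCount : RoomState → ℕ
  | .counted => 1
  | _ => 0

/-- The leader makes one more room ready; the last one receives the token, or, if all other
prisoners have completed their tours, the leader is done. -/
def postStep (n r d k : ℕ) : Memory × RoomState :=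
  if k + 1 < r then (.post d (k + 1), .ready)
  else if d + 1 < n then (.collect d 0, .token)
  else (.done, .token)

/-- The common rule of the prisoners, with modulus `m` and blank rooms worth `v`. A prisoner
becomes leader on combining two amounts that are not divisible by `m` into one that is. -/
def electionStep (n r m : ℕ) (v : ℤ) : Memory → RoomState → Memory × RoomState
  | .elect h, .blank =>
    if m = 1 ∨ (¬ (m : ℤ) ∣ h ∧ ¬ (m : ℤ) ∣ v ∧ (m : ℤ) ∣ h + v) then postStep n r 0 0
    else (.elect (h + v), .val 0)
  | .elect h, .val x =>
    if 0 < h then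
      if x = 0 then (.elect (h - m), .val m) else (.elect h, .val x)
    else if ¬ (m : ℤ) ∣ h ∧ ¬ (m : ℤ) ∣ x ∧ (m : ℤ) ∣ h + x then postStep n r 0 0
    else (.elect (min (h + x) 0), .val (max (h + x) 0))
  | .elect _, .token => (.active 1, .touched)
  | .active e, .ready => if e < r then (.active (e + 1), .touched) else (.active e, .ready)
  | .post d k, .ready => (.post d k, .ready)
  | .post d k, _ => postStep n r d k
  | .collect d k, .touched =>
    if k + 1 < r then (.collect d (k + 1), .counted) else (.post (d + 1) 0, .counted)
  | p, x => (p, x)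

/-- The machine followed by the prisoners, each of whom initially holds the amount `u`. -/
def electionMachine (n r m : ℕ) (u v : ℤ) : Machine Memory RoomState where
  start := .elect u
  blank := .blank
  step := electionStep n r m v
  final p := p = .done

/-! ### The states that rooms take -/

/-- The room states that can occur. -/
def RoomState.Good (r m : ℕ) : RoomState → Prop
  | .val x => 1 < m ∧ 0 ≤ x ∧ x ≤ m
  | .ready => 1 < r
  | _ => True

/-- Numbers for the room states that can occur, with those that need large `r` or `m` last. -/
def RoomState.code : RoomState → ℕ
  | .blank => 0
  | .token => 1
  | .touched => 2
  | .counted => 3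
  | .ready => 4
  | .val x => 5 + x.toNat

/-- The number of states that the protocol needs. -/
def stateBound (r m : ℕ) : ℕ := if 1 < m then m + 6 else if 1 < r then 5 else 4

theorem RoomState.code_lt {r m : ℕ} {x : RoomState} (hx : x.Good r m) :
    x.code < stateBound r m := by
  cases x
  all_goals
    simp only [RoomState.Good, RoomState.code, stateBound] at *
    grind

theorem RoomState.code_injOn {r m : ℕ} (x y : RoomState) (hx : x.Good r m) (hy : y.Good r m)
    (h : x.code = y.code) : x = y := by
  cases x <;> cases y <;> simp only [RoomState.Good, RoomState.code] at * <;> grind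

theorem good_postStep (n r m d k : ℕ) : (postStep n r d k).2.Good r m := by
  unfold postStep
  split_ifs <;> simp only [RoomState.Good]
  omega

theorem good_electionStep {n r m : ℕ} (hm : 0 < m) (v : ℤ) (p : Memory) (x : RoomState)
    (hx : x.Good r m) : (electionStep n r m v p x).2.Good r m := by
  unfold electionStep
  split <;> try split_ifs
  all_goals
    first
    | exact good_postStep _ _ _ _ _
    | (simp only [RoomState.Good] at *; grind)
    | trivial

/-! ### A decreasing measure -/

theorem sum_comp_update {ι α N : Type*} [Fintype ι] [DecidableEq ι] [AddCommMonoid N] (f : α → N)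
    (c : ι → α) (i : ι) (p : α) :
    ∑ k, f (Function.update c i p k) + f (c i) = ∑ k, f (c k) + f p := by
  have h : (fun k => f (Function.update c i p k)) = Function.update (fun k => f (c k)) i (f p) := by
    funext k
    by_cases hk : k = i
    · subst hk; simp
    · simp [hk]
  rw [h, Finset.sum_update_of_mem (Finset.mem_univ i), ← Finset.sum_sdiff
    (Finset.subset_univ {i}), Finset.sum_singleton]
  rw [add_comm (f p), add_assoc, add_assoc, add_comm (f p)]

/-- The contribution of a prisoner to the measure. -/
def Memory.cost (n r m : ℕ) : Memory → ℕ
  | .elect h => 2 * r * n + 1 + ((m + 1) * h.toNat + (-h).toNat)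
  | .active e => r - e
  | .post d k => 2 * r * (n - d) - k
  | .collect d k => 2 * r * (n - d) - r - k
  | .done => 0

/-- The contribution of a room to the measure: only its first visit can increase the amounts that
prisoners hold. -/
def RoomState.cost (m : ℕ) (v : ℤ) : RoomState → ℕ
  | .blank => (m + 2) * v.natAbs + 1
  | _ => 0

/-- The counters of a leader are within their bounds. -/
def Memory.WF (n r : ℕ) : Memory → Prop
  | .post d k => d < n ∧ k < r
  | .collect d k => d + 1 < n ∧ k < r
  | _ => True

theorem wf_postStep {n r d k : ℕ} (h : Memory.WF n r (.post d k)) :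
    (postStep n r d k).1.WF n r := by
  simp only [Memory.WF] at h
  unfold postStep
  split_ifs <;> simp only [Memory.WF] <;> omega

theorem wf_electionStep {n r m : ℕ} (hn : 0 < n) (hr : 0 < r) (v : ℤ) (p : Memory) (x : RoomState)
    (hp : p.WF n r) : (electionStep n r m v p x).1.WF n r := by
  unfold electionStep
  split <;> try split_ifs
  all_goals
    first
    | exact wf_postStep ⟨hn, hr⟩
    | exact wf_postStep hp
    | exact hp
    | (simp only [Memory.WF] at *; omega)

theorem cost_postStep {n r d k : ℕ} (m : ℕ) (v : ℤ) (h : Memory.WF n r (.post d k)) :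
    (postStep n r d k).1.cost n r m + (postStep n r d k).2.cost m v
      < Memory.cost n r m (.post d k) := by
  simp only [Memory.WF] at h
  have : 2 * r ≤ 2 * r * (n - d) := Nat.le_mul_of_pos_right _ (by omega)
  unfold postStep
  split_ifs <;> simp only [Memory.cost, RoomState.cost] <;> omega

/-- Every visit leaves everything as it is or decreases the measure. -/
theorem cost_electionStep {n r m : ℕ} (hn : 0 < n) (hr : 0 < r) (hm : 0 < m) (v : ℤ) (p : Memory)
    (x : RoomState) (hp : p.WF n r) (hx : x.Good r m) :
    electionStep n r m v p x = (p, x) ∨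
      (electionStep n r m v p x).1.cost n r m + (electionStep n r m v p x).2.cost m v
        < p.cost n r m + x.cost m v := by
  have hpost : ∀ h : ℤ, (postStep n r 0 0).1.cost n r m + (postStep n r 0 0).2.cost m v
      < Memory.cost n r m (.elect h) := by
    intro h
    have := cost_postStep m v (d := 0) (k := 0) (n := n) (r := r) ⟨hn, hr⟩
    have h0 : Memory.cost n r m (.post 0 0) = 2 * r * n := rfl
    have h1 : Memory.cost n r m (.elect h) =
      2 * r * n + 1 + ((m + 1) * h.toNat + (-h).toNat) := rfl
    omega
  unfold electionStep
  split
  case h_1 h =>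
    split_ifs
    · right
      have := hpost h
      omega
    · right
      simp only [Memory.cost, RoomState.cost]
      have h1 : (h + v).toNat ≤ h.toNat + v.natAbs := by omega
      have h2 : (-(h + v)).toNat ≤ (-h).toNat + v.natAbs := by omega
      have h3 := Nat.mul_le_mul_left (m + 1) h1
      have h4 : (m + 1) * (h.toNat + v.natAbs) = (m + 1) * h.toNat + (m + 1) * v.natAbs := by ring
      have h5 : (m + 2) * v.natAbs = (m + 1) * v.natAbs + v.natAbs := by ring
      omega
  case h_2 h x =>
    split_ifs with h1 h2 h3
    · right
      simp only [Memory.cost, RoomState.cost]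
      by_cases hm' : h ≤ m
      · have e1 : (h - m).toNat = 0 := by omega
        have e2 : (-(h - m)).toNat ≤ m := by omega
        have e3 : m + 1 ≤ (m + 1) * h.toNat := Nat.le_mul_of_pos_right _ (by omega)
        rw [e1]
        omega
      · have e1 : h.toNat = (h - m).toNat + m := by omega
        have e2 : (-(h - m)).toNat = 0 := by omega
        have e3 : 0 < (m + 1) * m := by positivity
        rw [e1, Nat.mul_add, e2]
        omega
    · exact Or.inl rfl
    · right
      have := hpost h
      omega
    · simp only [RoomState.Good] at hx
      by_cases hc : h = 0 ∨ x = 0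
      · left
        rw [min_def, max_def]
        split_ifs <;> simp <;> omega
      · right
        simp only [Memory.cost, RoomState.cost]
        have e1 : (min (h + x) 0).toNat = 0 := by omega
        have e2 : (-(min (h + x) 0)).toNat < (-h).toNat := by omega
        rw [e1]
        omega
  case h_3 =>
    right
    simp only [Memory.cost, RoomState.cost]
    have : r ≤ 2 * r * n := by nlinarith
    omega
  case h_4 e =>
    split_ifs
    · right
      simp only [Memory.cost, RoomState.cost]
      omega
    · exact Or.inl rfl
  case h_5 => exact Or.inl rfl
  case h_6 d k x hx' =>
    right
    have := cost_postStep m v hp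
    omega
  case h_7 d k =>
    right
    simp only [Memory.WF] at hp
    have e1 : 2 * r ≤ 2 * r * (n - d - 1) := Nat.le_mul_of_pos_right _ (by omega)
    have e2 : 2 * r * (n - d) = 2 * r * (n - d - 1) + 2 * r := by
      rw [← Nat.mul_succ]
      congr 1
      omega
    have e3 : n - (d + 1) = n - d - 1 := by omega
    split_ifs <;> simp only [Memory.cost, RoomState.cost, e3] <;> omega
  case h_8 => exact Or.inl rfl

section Trace

variable {n r m : ℕ} {u v : ℤ}

theorem visit_eq_self_or_cost_lt (hn : 0 < n) (hr : 0 < r) (hm : 0 < m)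
    (c : (Fin n → Memory) × (Fin r → RoomState)) (hwf : ∀ i, (c.1 i).WF n r)
    (hgood : ∀ j, (c.2 j).Good r m) (i : Fin n) (j : Fin r) :
    (electionMachine n r m u v).visit c i j = c ∨
      ∑ k, (((electionMachine n r m u v).visit c i j).1 k).cost n r m +
        ∑ k, (((electionMachine n r m u v).visit c i j).2 k).cost m v <
      ∑ k, (c.1 k).cost n r m + ∑ k, (c.2 k).cost m v := by
  simp only [Machine.visit, electionMachine]
  rcases cost_electionStep hn hr hm v _ _ (hwf i) (hgood j) with h | h
  · left
    rw [h, Function.update_eq_self, Function.update_eq_self]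
  · right
    have h1 := sum_comp_update (Memory.cost n r m) c.1 i (electionStep n r m v (c.1 i) (c.2 j)).1
    have h2 := sum_comp_update (RoomState.cost m v) c.2 j (electionStep n r m v (c.1 i) (c.2 j)).2
    omega

theorem wf_trace (hn : 0 < n) (hr : 0 < r) (s : Schedule n r) (t : ℕ) (i : Fin n) :
    (((electionMachine n r m u v).trace s t).1 i).WF n r := by
  induction t generalizing i with
  | zero => trivial
  | succ t ih =>
    simp only [Machine.trace, Machine.visit]
    by_cases hi : i = (s t).1
    · rw [hi, Function.update_self]
      exact wf_electionStep hn hr _ _ _ (ih _)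
    · rw [Function.update_of_ne hi]
      exact ih _

theorem good_trace (hm : 0 < m) (s : Schedule n r) (t : ℕ) (j : Fin r) :
    (((electionMachine n r m u v).trace s t).2 j).Good r m := by
  induction t generalizing j with
  | zero => trivial
  | succ t ih =>
    simp only [Machine.trace, Machine.visit]
    by_cases hj : j = (s t).2
    · rw [hj, Function.update_self]
      exact good_electionStep hm _ _ _ (ih _)
    · rw [Function.update_of_ne hj]
      exact ih _

/-- From some time on nothing changes, so that no visit at all would change anything. -/
theorem exists_stuck (hn : 0 < n) (hr : 0 < r) (hm : 0 < m) (s : Schedule n r) (hs : s.Valid) :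
    ∃ t, ∀ i j, electionStep n r m v (((electionMachine n r m u v).trace s t).1 i)
        (((electionMachine n r m u v).trace s t).2 j) =
      (((electionMachine n r m u v).trace s t).1 i,
        ((electionMachine n r m u v).trace s t).2 j) := by
  set M := electionMachine n r m u v
  let cost : ℕ → ℕ := fun t =>
    ∑ i, ((M.trace s t).1 i).cost n r m + ∑ j, ((M.trace s t).2 j).cost m v
  have hstep : ∀ t, M.trace s (t + 1) = M.trace s t ∨ cost (t + 1) < cost t := fun t =>
    visit_eq_self_or_cost_lt hn hr hm _ (wf_trace hn hr s t) (good_trace hm s t) _ _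
  obtain ⟨T, hT⟩ : ∃ T, ∀ t, cost T ≤ cost t :=
    ⟨Function.argmin cost, fun t => Function.argmin_le cost t⟩
  have hconst : ∀ k, M.trace s (T + k) = M.trace s T := by
    intro k
    induction k with
    | zero => rfl
    | succ k ih =>
      rcases hstep (T + k) with h | h
      · rw [← add_assoc, h, ih]
      · have h1 := hT (T + k + 1)
        have h2 : cost (T + k) = cost T := by simp only [cost, ih]
        omega
  refine ⟨T, fun i j => ?_⟩
  obtain ⟨t, ht, hst⟩ := hs i j T
  obtain ⟨k, rfl⟩ := Nat.exists_eq_add_of_le ht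
  have h : M.visit (M.trace s (T + k)) (s (T + k)).1 (s (T + k)).2 = M.trace s T :=
    hconst (k + 1)
  rw [hconst k, hst] at h
  have h1 := congrFun (congrArg Prod.fst h) i
  have h2 := congrFun (congrArg Prod.snd h) j
  simp only [Machine.visit, Function.update_self] at h1 h2
  exact Prod.ext h1 h2

end Trace

/-! ### After the election -/

section Led

variable {n r m d k e : ℕ} {v : ℤ} {c : (Fin n → Memory) × (Fin r → RoomState)}
  {V V' : Fin n → Fin r → Prop} {l p i : Fin n} {j : Fin r}

theorem eq_one_of_sum_eq {ι : Type*} [Fintype ι] (g : ι → ℕ) (hg : ∀ i, g i ≤ 1)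
    (h : ∑ i, g i = Fintype.card ι) (i : ι) : g i = 1 := by
  have := (Finset.sum_eq_sum_iff_of_le (s := Finset.univ) (f := g) (g := fun _ => 1)
    fun i _ => hg i).1 (by simpa using h)
  exact this i (Finset.mem_univ i)

theorem eq_one_of_sum_succ {ι : Type*} [Fintype ι] [DecidableEq ι] (g : ι → ℕ)
    (hg : ∀ i, g i ≤ 1) (i₀ : ι) (h₀ : g i₀ = 0) (h : ∑ i, g i + 1 = Fintype.card ι) (i : ι)
    (hi : i ≠ i₀) : g i = 1 := by
  have h1 := sum_comp_update (fun x : ℕ => x) g i₀ 1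
  have h2 := eq_one_of_sum_eq (Function.update g i₀ 1) (fun i => by
    by_cases hi : i = i₀
    · subst hi; simp
    · simpa [hi] using hg i) (by omega) i
  simpa [hi] using h2

theorem Memory.activeCount_le (p : Memory) : p.activeCount ≤ 1 := by
  cases p <;> simp [Memory.activeCount]

theorem RoomState.readyCount_le (x : RoomState) : x.readyCount ≤ 1 := by
  cases x <;> simp [RoomState.readyCount]

theorem RoomState.countedCount_le (x : RoomState) : x.countedCount ≤ 1 := by
  cases x <;> simp [RoomState.countedCount]

theorem Memory.eq_active {p : Memory} (h : p.activeCount = 1) : ∃ e, p = .active e := by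
  cases p <;> simp [Memory.activeCount] at h ⊢

theorem RoomState.eq_ready {x : RoomState} (h : x.readyCount = 1) : x = .ready := by
  cases x <;> simp [RoomState.readyCount] at h ⊢

theorem RoomState.eq_counted {x : RoomState} (h : x.countedCount = 1) : x = .counted := by
  cases x <;> simp [RoomState.countedCount] at h ⊢

theorem RoomState.readyCount_of_ne {x : RoomState} (h : x ≠ .ready) : x.readyCount = 0 := by
  cases x <;> simp [RoomState.readyCount] at h ⊢

/-- Prisoner `l` is the only leader: the other prisoners still in the election, and the rooms not
yet marked by the leader, hold multiples of `m` only, and can never produce a second leader.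
`V i j` says that prisoner `i` has visited room `j`. -/
structure Led (m : ℕ) (v : ℤ) (c : (Fin n → Memory) × (Fin r → RoomState))
    (V : Fin n → Fin r → Prop) (l : Fin n) : Prop where
  others : ∀ i, i ≠ l → (∃ h, c.1 i = .elect h ∧ (m : ℤ) ∣ h) ∨ ∃ e, c.1 i = .active e
  rooms : ∀ j, (m : ℤ) ∣ (c.2 j).value v
  unique : m = 1 → ∀ i h j, i ≠ l → c.1 i = .elect h → c.2 j ≠ .blank
  visited : ∀ j, (c.2 j).Marked → V l j

/-- The leader is making the rooms ready. -/
structure Posting (m : ℕ) (v : ℤ) (c : (Fin n → Memory) × (Fin r → RoomState))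
    (V : Fin n → Fin r → Prop) (l : Fin n) (d k : ℕ) : Prop extends Led m v c V l where
  leader : c.1 l = .post d k
  k_lt : k < r
  d_lt : d < n
  ready : ∑ j, (c.2 j).readyCount = k
  token : ∀ j, c.2 j ≠ .token
  veterans : ∀ i e, c.1 i = .active e → e = r ∧ ∀ j, V i j
  tours : ∑ i, (c.1 i).activeCount = d

/-- The token is waiting for a prisoner who has not yet made a tour. -/
structure Waiting (m : ℕ) (v : ℤ) (c : (Fin n → Memory) × (Fin r → RoomState))
    (V : Fin n → Fin r → Prop) (l : Fin n) (d : ℕ) : Prop extends Led m v c V l where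
  leader : c.1 l = .collect d 0
  d_lt : d + 1 < n
  token : ∃ j₀, c.2 j₀ = .token ∧ ∀ j, j ≠ j₀ → c.2 j = .ready
  veterans : ∀ i e, c.1 i = .active e → e = r ∧ ∀ j, V i j
  tours : ∑ i, (c.1 i).activeCount = d

/-- Prisoner `p` is on tour and has touched `e` rooms, of which the leader has counted `k`. -/
structure Touring (m : ℕ) (v : ℤ) (c : (Fin n → Memory) × (Fin r → RoomState))
    (V : Fin n → Fin r → Prop) (l : Fin n) (d k e : ℕ) (p : Fin n) : Prop
    extends Led m v c V l where
  leader : c.1 l = .collect d k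
  k_lt : k < r
  d_lt : d + 1 < n
  ne : p ≠ l
  tourist : c.1 p = .active e
  marks : ∀ j, c.2 j = .ready ∨ c.2 j = .touched ∨ c.2 j = .counted
  ready : ∑ j, (c.2 j).readyCount + e = r
  counted : ∑ j, (c.2 j).countedCount = k
  toured : ∀ j, c.2 j ≠ .ready → V p j
  veterans : ∀ i e, i ≠ p → c.1 i = .active e → e = r ∧ ∀ j, V i j
  tours : ∑ i, (c.1 i).activeCount = d + 1

/-- The leader is done, and rightly so. -/
def Finished (c : (Fin n → Memory) × (Fin r → RoomState)) (V : Fin n → Fin r → Prop) : Prop :=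
  (∃ i, c.1 i = .done) ∧ ∀ i j, V i j

/-- A leader has been elected. -/
def AfterElection (m : ℕ) (v : ℤ) (c : (Fin n → Memory) × (Fin r → RoomState))
    (V : Fin n → Fin r → Prop) : Prop :=
  (∃ l d k, Posting m v c V l d k) ∨ (∃ l d, Waiting m v c V l d) ∨
    (∃ l d k e p, Touring m v c V l d k e p) ∨ Finished c V

theorem Led.mono (h : Led m v c V l) (hV : ∀ i j, V i j → V' i j) : Led m v c V' l :=
  { h with visited := fun j hj => hV _ _ (h.visited j hj) }

theorem AfterElection.mono (h : AfterElection m v c V) (hV : ∀ i j, V i j → V' i j) :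
    AfterElection m v c V' := by
  rcases h with ⟨l, d, k, h⟩ | ⟨l, d, h⟩ | ⟨l, d, k, e, p, h⟩ | h
  · exact Or.inl ⟨l, d, k, { h with
      toLed := h.toLed.mono hV
      veterans := fun i e hi =>
        ⟨(h.veterans i e hi).1, fun j => hV _ _ ((h.veterans i e hi).2 j)⟩ }⟩
  · exact Or.inr (Or.inl ⟨l, d, { h with
      toLed := h.toLed.mono hV
      veterans := fun i e hi =>
        ⟨(h.veterans i e hi).1, fun j => hV _ _ ((h.veterans i e hi).2 j)⟩ }⟩)
  · exact Or.inr (Or.inr (Or.inl ⟨l, d, k, e, p, { h with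
      toLed := h.toLed.mono hV
      toured := fun j hj => hV _ _ (h.toured j hj)
      veterans := fun i e hp hi =>
        ⟨(h.veterans i e hp hi).1, fun j => hV _ _ ((h.veterans i e hp hi).2 j)⟩ }⟩))
  · exact Or.inr (Or.inr (Or.inr ⟨h.1, fun i j => hV _ _ (h.2 i j)⟩))

/-- Changing the memory of one prisoner and the state of one room. -/
theorem Led.update (h : Led m v c V l) (hV : ∀ i j, V i j → V' i j) (q : Memory) (x : RoomState)
    (hq : i ≠ l → (∃ h, q = .elect h ∧ (m : ℤ) ∣ h) ∨ ∃ e, q = .active e)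
    (hq' : i ≠ l → ∀ g, q = .elect g → ∃ g', c.1 i = .elect g')
    (hx : (m : ℤ) ∣ x.value v) (hx' : x ≠ .blank) (hV' : x.Marked → V' l j) :
    Led m v (Function.update c.1 i q, Function.update c.2 j x) V' l where
  others i' hi' := by
    by_cases hi : i' = i
    · subst hi; simpa using hq hi'
    · simpa [hi] using h.others i' hi'
  rooms j' := by
    by_cases hj : j' = j
    · subst hj; simpa using hx
    · simpa [hj] using h.rooms j'
  unique hm i' g j' hi' he := by
    by_cases hj : j' = j
    · subst hj; simpa using hx'
    · simp only [Function.update_of_ne hj]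
      by_cases hi : i' = i
      · subst hi
        simp only [Function.update_self] at he
        obtain ⟨g', hg'⟩ := hq' hi' g he
        exact h.unique hm i' g' j' hi' hg'
      · simp only [Function.update_of_ne hi] at he
        exact h.unique hm i' g j' hi' he
  visited j' hj' := by
    by_cases hj : j' = j
    · subst hj; exact hV' (by simpa using hj')
    · exact hV _ _ (h.visited j' (by simpa [hj] using hj'))

/-- Multiples of `m` do not produce a leader. -/
theorem electionStep_elect_of_dvd (n r : ℕ) {g : ℤ} {x : RoomState} (hg : (m : ℤ) ∣ g)
    (hx : (m : ℤ) ∣ x.value v) (hx' : ¬ x.Marked) (h1 : m = 1 → x ≠ .blank) :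
    ∃ g' x', electionStep n r m v (.elect g) x = (.elect g', x') ∧ (m : ℤ) ∣ g' ∧
      (m : ℤ) ∣ x'.value v ∧ ¬ x'.Marked ∧ x' ≠ .blank := by
  cases x with
  | blank =>
    refine ⟨g + v, .val 0, ?_, dvd_add hg hx, ?_, ?_, ?_⟩
    · have : m ≠ 1 := fun h => h1 h rfl
      simp [electionStep, this, hg]
    all_goals simp [RoomState.value, RoomState.Marked]
  | val y =>
    simp only [RoomState.value] at hx
    simp only [electionStep, hg, not_true_eq_false, false_and, if_false]
    split_ifs with h2 h3
    · exact ⟨_, _, rfl, dvd_sub_self_right.2 hg, by simp [RoomState.value], by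
        simp [RoomState.Marked], by simp⟩
    · exact ⟨_, _, rfl, hg, hx, by simp [RoomState.Marked], by simp⟩
    · refine ⟨_, _, rfl, ?_, ?_, by simp [RoomState.Marked], by simp⟩
      · rcases min_choice (g + y) 0 with h | h <;> rw [h]
        exacts [dvd_add hg hx, dvd_zero _]
      · rcases max_choice (g + y) 0 with h | h <;> rw [RoomState.value, h]
        exacts [dvd_add hg hx, dvd_zero _]
  | _ => simp [RoomState.Marked] at hx'

/-- The leader enters a room that is not ready. The invariant is reestablished, or the leader is
done, in which case all others have completed their tours. -/
theorem Posting.postStep (h : Posting m v c V l d k) (hV : ∀ i j, V i j → V' i j) (hVj : V' l j)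
    (hj : c.2 j ≠ .ready) :
    AfterElection m v (Function.update c.1 l (postStep n r d k).1,
      Function.update c.2 j (postStep n r d k).2) V' := by
  have hk := h.k_lt
  have hd := h.d_lt
  have hready := h.ready
  have hready' : k + 1 = r → ∀ j', j' ≠ j → c.2 j' = .ready := by
    intro hk' j' hj'
    exact RoomState.eq_ready (eq_one_of_sum_succ (fun j => (c.2 j).readyCount)
      (fun j => RoomState.readyCount_le _) j (RoomState.readyCount_of_ne hj)
      (by simpa [hready] using hk') j' hj')
  have htours := h.tours
  have hveterans : ∀ q : Memory, q.activeCount = 0 → ∀ i e,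
      Function.update c.1 l q i = .active e → e = r ∧ ∀ j, V' i j := by
    intro q hq i e he
    by_cases hi : i = l
    · subst hi
      simp only [Function.update_self] at he
      simp [he, Memory.activeCount] at hq
    · simp only [Function.update_of_ne hi] at he
      exact ⟨(h.veterans i e he).1, fun j => hV _ _ ((h.veterans i e he).2 j)⟩
  have hcount : ∀ q : Memory, q.activeCount = 0 →
      ∑ i, (Function.update c.1 l q i).activeCount = d := by
    intro q hq
    have := sum_comp_update Memory.activeCount c.1 l q
    rw [hq, h.leader, htours] at this
    simpa [Memory.activeCount] using this
  unfold _root_.postStep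
  split_ifs with h1 h2
  · refine Or.inl ⟨l, d, k + 1, ?_⟩
    exact {
      toLed := h.toLed.update hV _ _ (by simp) (by simp) (by simp [RoomState.value]) (by simp)
        fun _ => hVj
      leader := by simp
      k_lt := h1
      d_lt := hd
      ready := by
        have := sum_comp_update RoomState.readyCount c.2 j .ready
        rw [RoomState.readyCount_of_ne hj, hready] at this
        simpa [RoomState.readyCount] using this
      token := fun j' => by
        by_cases hj' : j' = j
        · subst hj'; simp
        · simpa [hj'] using h.token j'
      veterans := hveterans _ rfl
      tours := hcount _ rfl }
  · refine Or.inr (Or.inl ⟨l, d, ?_⟩)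
    exact {
      toLed := h.toLed.update hV _ _ (by simp) (by simp) (by simp [RoomState.value]) (by simp)
        fun _ => hVj
      leader := by simp
      d_lt := h2
      token := ⟨j, by simp, fun j' hj' => by simpa [hj'] using hready' (by omega) j' hj'⟩
      veterans := hveterans _ rfl
      tours := hcount _ rfl }
  · refine Or.inr (Or.inr (Or.inr ⟨⟨l, by simp⟩, fun i j' => ?_⟩))
    by_cases hi : i = l
    · subst hi
      by_cases hj' : j' = j
      · exact hj' ▸ hVj
      · refine hV _ _ (h.visited j' ?_)
        rw [hready' (by omega) j' hj']
        trivial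
    · obtain ⟨e, he⟩ := Memory.eq_active (eq_one_of_sum_succ (fun i => (c.1 i).activeCount)
        (fun i => Memory.activeCount_le _) l (by simp [h.leader, Memory.activeCount])
        (by rw [htours, Fintype.card_fin]; omega) i hi)
      exact hV _ _ ((h.veterans i e he).2 j')

theorem visit_electionMachine {u : ℤ} (c : (Fin n → Memory) × (Fin r → RoomState)) (i : Fin n)
    (j : Fin r) : (electionMachine n r m u v).visit c i j =
      (Function.update c.1 i (electionStep n r m v (c.1 i) (c.2 j)).1,
        Function.update c.2 j (electionStep n r m v (c.1 i) (c.2 j)).2) := rfl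

theorem visit_eq_self {u : ℤ} (h : electionStep n r m v (c.1 i) (c.2 j) = (c.1 i, c.2 j)) :
    (electionMachine n r m u v).visit c i j = c := by
  rw [visit_electionMachine, h, Function.update_eq_self, Function.update_eq_self]

theorem Posting.visit {u : ℤ} (h : Posting m v c V l d k) (hV : ∀ i j, V i j → V' i j)
    (hVj : V' i j) : AfterElection m v ((electionMachine n r m u v).visit c i j) V' := by
  have noop : electionStep n r m v (c.1 i) (c.2 j) = (c.1 i, c.2 j) →
      AfterElection m v ((electionMachine n r m u v).visit c i j) V' := by
    intro h'
    rw [visit_eq_self h']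
    exact AfterElection.mono (Or.inl ⟨l, d, k, h⟩) hV
  by_cases hi : i = l
  · subst hi
    by_cases hj : c.2 j = .ready
    · apply noop
      rw [h.leader, hj, electionStep]
    · have : electionStep n r m v (c.1 i) (c.2 j) = _root_.postStep n r d k := by
        rw [h.leader, electionStep]
        exact hj
      rw [visit_electionMachine, this]
      exact h.postStep hV hVj hj
  · rcases h.others i hi with ⟨g, hg, hmg⟩ | ⟨e, he⟩
    · by_cases hx : (c.2 j).Marked
      · apply noop
        have := h.token j
        rw [hg]
        cases hc : c.2 j <;> simp_all [RoomState.Marked, electionStep]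
      · obtain ⟨g', x', hs, hg', hx', hmark, hbl⟩ :=
          electionStep_elect_of_dvd n r hmg (h.rooms j) hx fun hm => h.unique hm i g j hi hg
        rw [visit_electionMachine, hg, hs]
        refine Or.inl ⟨l, d, k, ?_⟩
        have hnr : ∀ x : RoomState, ¬ x.Marked → x.readyCount = 0 := by
          intro x hx
          cases x <;> simp_all [RoomState.Marked, RoomState.readyCount]
        exact {
          toLed := h.toLed.update hV _ _ (fun _ => Or.inl ⟨g', rfl, hg'⟩) (fun _ _ _ => ⟨g, hg⟩)
            hx' hbl fun hm => (hmark hm).elim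
          leader := by simpa [Ne.symm hi] using h.leader
          k_lt := h.k_lt
          d_lt := h.d_lt
          ready := by
            have := sum_comp_update RoomState.readyCount c.2 j x'
            rw [hnr _ hx, hnr _ hmark, h.ready] at this
            simpa using this
          token := fun j' => by
            by_cases hj' : j' = j
            · subst hj'
              simp only [Function.update_self]
              rintro rfl
              exact hmark trivial
            · simpa [hj'] using h.token j'
          veterans := fun i' e he => by
            by_cases hi' : i' = i
            · subst hi'; simp at he
            · simp only [Function.update_of_ne hi'] at he
              exact ⟨(h.veterans i' e he).1, fun j => hV _ _ ((h.veterans i' e he).2 j)⟩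
          tours := by
            have := sum_comp_update Memory.activeCount c.1 i (.elect g')
            rw [hg, h.tours] at this
            simpa [Memory.activeCount] using this }
    · apply noop
      have := (h.veterans i e he).1
      rw [he]
      cases hc : c.2 j <;> simp [electionStep, this]

theorem Waiting.visit {u : ℤ} (h : Waiting m v c V l d) (hV : ∀ i j, V i j → V' i j)
    (hVj : V' i j) : AfterElection m v ((electionMachine n r m u v).visit c i j) V' := by
  have noop : electionStep n r m v (c.1 i) (c.2 j) = (c.1 i, c.2 j) →
      AfterElection m v ((electionMachine n r m u v).visit c i j) V' := by
    intro h'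
    rw [visit_eq_self h']
    exact AfterElection.mono (Or.inr (Or.inl ⟨l, d, h⟩)) hV
  obtain ⟨j₀, hj₀, hready⟩ := h.token
  by_cases hi : i = l
  · subst hi
    apply noop
    rw [h.leader]
    by_cases hj : j = j₀
    · rw [hj, hj₀]; rfl
    · rw [hready j hj]; rfl
  · rcases h.others i hi with ⟨g, hg, -⟩ | ⟨e, he⟩
    · by_cases hj : j = j₀
      · subst hj
        rw [visit_electionMachine, hg, hj₀, electionStep]
        refine Or.inr (Or.inr (Or.inl ⟨l, d, 0, 1, i, ?_⟩))
        have hr : 0 < r := j.pos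
        have hready' : ∑ j', (c.2 j').readyCount + 1 = r := by
          have h1 := sum_comp_update RoomState.readyCount c.2 j .ready
          have h2 : ∀ j', (Function.update c.2 j .ready j').readyCount = 1 := by
            intro j'
            by_cases hj' : j' = j
            · subst hj'; simp [RoomState.readyCount]
            · simp [hj', hready j' hj', RoomState.readyCount]
          simp only [h2, hj₀] at h1
          simpa [RoomState.readyCount] using h1.symm
        exact {
          toLed := h.toLed.update hV _ _ (by simp) (by simp) (by simp [RoomState.value]) (by simp)
            fun _ => hV _ _ (h.visited j (by rw [hj₀]; trivial))
          leader := by simpa [Ne.symm hi] using h.leader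
          k_lt := hr
          d_lt := h.d_lt
          ne := hi
          tourist := by simp
          marks := fun j' => by
            by_cases hj' : j' = j
            · subst hj'; simp
            · simp [hj', hready j' hj']
          ready := by
            have := sum_comp_update RoomState.readyCount c.2 j .touched
            rw [hj₀] at this
            simp only [RoomState.readyCount] at this hready' ⊢
            omega
          counted := by
            refine Finset.sum_eq_zero fun j' _ => ?_
            by_cases hj' : j' = j
            · subst hj'; simp [RoomState.countedCount]
            · simp [hj', hready j' hj', RoomState.countedCount]
          toured := fun j' hj' => by
            by_cases hj'' : j' = j
            · subst hj''; exact hVj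
            · simp [hj'', hready j' hj''] at hj'
          veterans := fun i' e hi' he => by
            simp only [Function.update_of_ne hi'] at he
            exact ⟨(h.veterans i' e he).1, fun j => hV _ _ ((h.veterans i' e he).2 j)⟩
          tours := by
            have := sum_comp_update Memory.activeCount c.1 i (.active 1)
            rw [hg, h.tours] at this
            simpa [Memory.activeCount] using this }
      · apply noop
        rw [hg, hready j hj]; rfl
    · apply noop
      have := (h.veterans i e he).1
      rw [he]
      cases hc : c.2 j <;> simp [electionStep, this]

theorem Touring.visit {u : ℤ} (h : Touring m v c V l d k e p) (hV : ∀ i j, V i j → V' i j)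
    (hVj : V' i j) : AfterElection m v ((electionMachine n r m u v).visit c i j) V' := by
  have noop : electionStep n r m v (c.1 i) (c.2 j) = (c.1 i, c.2 j) →
      AfterElection m v ((electionMachine n r m u v).visit c i j) V' := by
    intro h'
    rw [visit_eq_self h']
    exact AfterElection.mono (Or.inr (Or.inr (Or.inl ⟨l, d, k, e, p, h⟩))) hV
  have hk := h.k_lt
  have hvisited : ∀ j, V l j := fun j => h.visited j (by
    rcases h.marks j with h | h | h <;> rw [h] <;> trivial)
  by_cases hi : i = l
  · subst hi
    rcases h.marks j with hj | hj | hj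
    · apply noop
      rw [h.leader, hj]; rfl
    · have hcounted : ∑ j', (Function.update c.2 j .counted j').countedCount = k + 1 := by
        have := sum_comp_update RoomState.countedCount c.2 j .counted
        rw [hj, h.counted] at this
        simpa [RoomState.countedCount] using this
      have hready : ∑ j', (Function.update c.2 j .counted j').readyCount + e = r := by
        have := sum_comp_update RoomState.readyCount c.2 j .counted
        rw [hj] at this
        have h2 := h.ready
        simp only [RoomState.readyCount] at this h2 ⊢
        omega
      have htours : ∀ q : Memory, q.activeCount = 0 →
          ∑ i', (Function.update c.1 i q i').activeCount = d + 1 := by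
        intro q hq
        have := sum_comp_update Memory.activeCount c.1 i q
        rw [hq, h.leader, h.tours] at this
        simpa [Memory.activeCount] using this
      rw [visit_electionMachine, h.leader, hj, electionStep]
      split_ifs with h1
      · refine Or.inr (Or.inr (Or.inl ⟨i, d, k + 1, e, p, ?_⟩))
        exact {
          toLed := h.toLed.update hV _ _ (by simp) (by simp) (by simp [RoomState.value]) (by simp)
            fun _ => hVj
          leader := by simp
          k_lt := h1
          d_lt := h.d_lt
          ne := h.ne
          tourist := by simpa [h.ne] using h.tourist
          marks := fun j' => by
            by_cases hj' : j' = j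
            · subst hj'; simp
            · simpa [hj'] using h.marks j'
          ready := hready
          counted := hcounted
          toured := fun j' hj' => by
            by_cases hj'' : j' = j
            · subst hj''; exact hV _ _ (h.toured j' (by simp [hj]))
            · exact hV _ _ (h.toured j' (by simpa [hj''] using hj'))
          veterans := fun i' e hi' he => by
            by_cases hi'' : i' = i
            · subst hi''; simp at he
            · simp only [Function.update_of_ne hi''] at he
              exact ⟨(h.veterans i' e hi' he).1, fun j => hV _ _ ((h.veterans i' e hi' he).2 j)⟩
          tours := htours _ rfl }
      · refine Or.inl ⟨i, d + 1, 0, ?_⟩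
        have hall : ∀ j', Function.update c.2 j .counted j' = .counted := fun j' =>
          RoomState.eq_counted (eq_one_of_sum_eq
            (fun j' => (Function.update c.2 j .counted j').countedCount)
            (fun j => RoomState.countedCount_le _)
            (by rw [hcounted, Fintype.card_fin]; omega) j')
        have hready0 : ∑ j', (Function.update c.2 j .counted j').readyCount = 0 :=
          Finset.sum_eq_zero fun j' _ => by rw [hall]; rfl
        have her : e = r := by omega
        exact {
          toLed := h.toLed.update hV _ _ (by simp) (by simp) (by simp [RoomState.value]) (by simp)
            fun _ => hVj
          leader := by simp
          k_lt := by omega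
          d_lt := h.d_lt
          ready := hready0
          token := fun j' => by
            have := hall j'
            simp only [this]
            simp
          veterans := fun i' e' he => by
            by_cases hi'' : i' = i
            · subst hi''; simp at he
            · simp only [Function.update_of_ne hi''] at he
              by_cases hp : i' = p
              · subst hp
                have h1 := h.tourist
                rw [he] at h1
                simp only [Memory.active.injEq] at h1
                refine ⟨h1.trans her, fun j' => hV _ _ (h.toured j' ?_)⟩
                by_cases hj' : j' = j
                · rw [hj', hj]; simp
                · have := hall j'
                  rw [Function.update_of_ne hj'] at this
                  rw [this]; simp
              · exact ⟨(h.veterans i' e' hp he).1,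
                  fun j => hV _ _ ((h.veterans i' e' hp he).2 j)⟩
          tours := htours _ rfl }
    · apply noop
      rw [h.leader, hj]; rfl
  · by_cases hp : i = p
    · subst hp
      by_cases hj : c.2 j = .ready
      · have her : e < r := by
          have h1 : (c.2 j).readyCount ≤ ∑ j, (c.2 j).readyCount :=
            Finset.single_le_sum (f := fun j => (c.2 j).readyCount) (fun _ _ => Nat.zero_le _)
            (Finset.mem_univ j)
          rw [hj] at h1
          have h2 := h.ready
          simp only [RoomState.readyCount] at h1 h2
          omega
        rw [visit_electionMachine, h.tourist, hj, electionStep, if_pos her]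
        refine Or.inr (Or.inr (Or.inl ⟨l, d, k, e + 1, i, ?_⟩))
        exact {
          toLed := h.toLed.update hV _ _ (by simp) (by simp) (by simp [RoomState.value]) (by simp)
            fun _ => hV _ _ (hvisited j)
          leader := by simpa [Ne.symm hi] using h.leader
          k_lt := hk
          d_lt := h.d_lt
          ne := hi
          tourist := by simp
          marks := fun j' => by
            by_cases hj' : j' = j
            · subst hj'; simp
            · simpa [hj'] using h.marks j'
          ready := by
            have := sum_comp_update RoomState.readyCount c.2 j .touched
            rw [hj] at this
            have h2 := h.ready
            simp only [RoomState.readyCount] at this h2 ⊢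
            omega
          counted := by
            have := sum_comp_update RoomState.countedCount c.2 j .touched
            rw [hj, h.counted] at this
            simpa [RoomState.countedCount] using this
          toured := fun j' hj' => by
            by_cases hj'' : j' = j
            · subst hj''; exact hVj
            · exact hV _ _ (h.toured j' (by simpa [hj''] using hj'))
          veterans := fun i' e hi' he => by
            simp only [Function.update_of_ne hi'] at he
            exact ⟨(h.veterans i' e hi' he).1, fun j => hV _ _ ((h.veterans i' e hi' he).2 j)⟩
          tours := by
            have := sum_comp_update Memory.activeCount c.1 i (.active (e + 1))
            rw [h.tourist, h.tours] at this
            simpa [Memory.activeCount] using this }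
      · apply noop
        rw [h.tourist]
        rcases h.marks j with hj' | hj' | hj'
        · exact (hj hj').elim
        all_goals rw [hj']; rfl
    · apply noop
      rcases h.others i hi with ⟨g, hg, -⟩ | ⟨e', he⟩
      · rw [hg]
        rcases h.marks j with hj' | hj' | hj' <;> rw [hj'] <;> rfl
      · rw [he, (h.veterans i e' hp he).1]
        rcases h.marks j with hj' | hj' | hj' <;> rw [hj'] <;> simp [electionStep]

theorem AfterElection.visit {u : ℤ} (h : AfterElection m v c V) (hV : ∀ i j, V i j → V' i j)
    (hVj : V' i j) : AfterElection m v ((electionMachine n r m u v).visit c i j) V' := by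
  rcases h with ⟨l, d, k, h⟩ | ⟨l, d, h⟩ | ⟨l, d, k, e, p, h⟩ | ⟨⟨l, hl⟩, h⟩
  · exact h.visit hV hVj
  · exact h.visit hV hVj
  · exact h.visit hV hVj
  · refine Or.inr (Or.inr (Or.inr ⟨⟨l, ?_⟩, fun i j => hV _ _ (h i j)⟩))
    rw [visit_electionMachine]
    by_cases hi : l = i
    · subst hi
      simp [hl, electionStep]
    · simpa [hi] using hl

/-- The leader does not get stuck. -/
theorem AfterElection.finished_of_stuck (h : AfterElection m v c V)
    (hs : ∀ i j, electionStep n r m v (c.1 i) (c.2 j) = (c.1 i, c.2 j)) : Finished c V := by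
  rcases h with ⟨l, d, k, h⟩ | ⟨l, d, h⟩ | ⟨l, d, k, e, p, h⟩ | h
  · exfalso
    by_cases hall : ∀ j, c.2 j = .ready
    · have h1 := h.ready
      have h2 := h.k_lt
      simp only [hall, RoomState.readyCount, Finset.sum_const, Finset.card_univ,
        Fintype.card_fin, smul_eq_mul] at h1
      omega
    · push Not at hall
      obtain ⟨j, hj⟩ := hall
      have h1 := hs l j
      have h2 : electionStep n r m v (.post d k) (c.2 j) = _root_.postStep n r d k := by
        rw [electionStep]
        exact hj
      rw [h.leader, h2] at h1
      unfold _root_.postStep at h1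
      split_ifs at h1 <;> simp at h1
  · exfalso
    obtain ⟨j₀, hj₀, -⟩ := h.token
    by_cases hall : ∀ i, i ≠ l → (c.1 i).activeCount = 1
    · have h1 := sum_comp_update Memory.activeCount c.1 l (.active 0)
      have h2 : ∀ i, (Function.update c.1 l (.active 0) i).activeCount = 1 := by
        intro i
        by_cases hi : i = l
        · subst hi; simp [Memory.activeCount]
        · simpa [hi] using hall i hi
      rw [h.leader, h.tours] at h1
      simp only [h2] at h1
      have h3 := h.d_lt
      simp [Memory.activeCount] at h1
      omega
    · push Not at hall
      obtain ⟨i, hi, hact⟩ := hall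
      rcases h.others i hi with ⟨g, hg, -⟩ | ⟨e, he⟩
      · have h1 := hs i j₀
        rw [hg, hj₀, electionStep] at h1
        simp at h1
      · exact hact (by rw [he]; rfl)
  · exfalso
    by_cases hready : ∃ j, c.2 j = .ready
    · obtain ⟨j, hj⟩ := hready
      have h1 := hs p j
      have her : e < r := by
        have h1 : (c.2 j).readyCount ≤ ∑ j, (c.2 j).readyCount :=
          Finset.single_le_sum (f := fun j => (c.2 j).readyCount) (fun _ _ => Nat.zero_le _)
            (Finset.mem_univ j)
        rw [hj] at h1
        have h2 := h.ready
        simp only [RoomState.readyCount] at h1 h2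
        omega
      rw [h.tourist, hj, electionStep, if_pos her] at h1
      simp at h1
    · by_cases hall : ∀ j, c.2 j = .counted
      · have h1 := h.counted
        have h2 := h.k_lt
        simp only [hall, RoomState.countedCount, Finset.sum_const, Finset.card_univ,
          Fintype.card_fin, smul_eq_mul] at h1
        omega
      · push Not at hall
        obtain ⟨j, hj⟩ := hall
        rcases h.marks j with hj' | hj' | hj'
        · exact hready ⟨j, hj'⟩
        · have h1 := hs l j
          rw [h.leader, hj', electionStep] at h1
          split_ifs at h1 <;> simp at h1
        · exact hj hj'
  · exact h

end Led

/-! ### The election -/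

section Electing

variable {n r m : ℕ} {u v w : ℤ} {c : (Fin n → Memory) × (Fin r → RoomState)}
  {a : Fin n → ℤ} {b : Fin r → ℤ} {V V' : Fin n → Fin r → Prop} {i : Fin n} {j : Fin r}

/-- No leader has been elected. The total weight `m` is distributed over the prisoners (weights
`a`) and the rooms (weights `b`), and each of them holds, modulo `m`, the `w`-fold of its weight. -/
structure Electing (m : ℕ) (v w : ℤ) (c : (Fin n → Memory) × (Fin r → RoomState))
    (a : Fin n → ℤ) (b : Fin r → ℤ) : Prop where
  hands : ∀ i, ∃ h, c.1 i = .elect h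
  rooms : ∀ j, c.2 j = .blank ∨ ∃ x, 0 ≤ x ∧ c.2 j = .val x
  total : ∑ i, (c.1 i).value + ∑ j, (c.2 j).value v = 0
  hand_weight : ∀ i, (m : ℤ) ∣ (c.1 i).value - w * a i
  room_weight : ∀ j, (m : ℤ) ∣ (c.2 j).value v - w * b j
  hand_nonneg : ∀ i, 0 ≤ a i
  room_nonneg : ∀ j, 0 ≤ b j
  weight : ∑ i, a i + ∑ j, b j = m
  hand_lt : 1 < m → ∀ i, a i < m
  room_lt : 1 < m → ∀ j, b j < m
  fresh : m = 1 → ∀ j, c.2 j = .blank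

/-- A visit that redistributes amounts and weights between a prisoner and a room. -/
theorem Electing.update (h : Electing m v w c a b) (hm : 1 < m) {g x : ℤ} {α β : ℤ} (hx : 0 ≤ x)
    (hsum : g + x = (c.1 i).value + (c.2 j).value v) (hα : 0 ≤ α) (hβ : 0 ≤ β)
    (hαβ : α + β = a i + b j) (hα' : α < m) (hβ' : β < m) (hg : (m : ℤ) ∣ g - w * α)
    (hx' : (m : ℤ) ∣ x - w * β) :
    Electing m v w (Function.update c.1 i (.elect g), Function.update c.2 j (.val x))
      (Function.update a i α) (Function.update b j β) where
  hands i' := by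
    by_cases hi : i' = i
    · subst hi; simp
    · simpa [hi] using h.hands i'
  rooms j' := by
    by_cases hj : j' = j
    · subst hj; simp [hx]
    · simpa [hj] using h.rooms j'
  total := by
    have h1 := sum_comp_update Memory.value c.1 i (.elect g)
    have h2 := sum_comp_update (RoomState.value v) c.2 j (.val x)
    have h3 := h.total
    have h4 : Memory.value (.elect g) = g := rfl
    have h5 : RoomState.value v (.val x) = x := rfl
    simp only
    linarith
  hand_weight i' := by
    by_cases hi : i' = i
    · subst hi; simpa [Memory.value] using hg
    · simpa [hi] using h.hand_weight i'
  room_weight j' := by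
    by_cases hj : j' = j
    · subst hj; simpa [RoomState.value] using hx'
    · simpa [hj] using h.room_weight j'
  hand_nonneg i' := by
    by_cases hi : i' = i
    · subst hi; simpa using hα
    · simpa [hi] using h.hand_nonneg i'
  room_nonneg j' := by
    by_cases hj : j' = j
    · subst hj; simpa using hβ
    · simpa [hj] using h.room_nonneg j'
  weight := by
    have h1 := sum_comp_update (fun y : ℤ => y) a i α
    have h2 := sum_comp_update (fun y : ℤ => y) b j β
    have h3 := h.weight
    linarith
  hand_lt _ i' := by
    by_cases hi : i' = i
    · subst hi; simpa using hα'
    · simpa [hi] using h.hand_lt hm i'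
  room_lt _ j' := by
    by_cases hj : j' = j
    · subst hj; simpa using hβ'
    · simpa [hj] using h.room_lt hm j'
  fresh h1 := by omega

theorem dvd_iff_dvd_weight {y α : ℤ} (hw : IsCoprime w (m : ℤ)) (h : (m : ℤ) ∣ y - w * α) :
    (m : ℤ) ∣ y ↔ (m : ℤ) ∣ α := by
  rw [dvd_iff_dvd_of_dvd_sub h]
  exact ⟨fun h => hw.symm.dvd_of_dvd_mul_left h, fun h => h.mul_left w⟩

theorem Electing.hand_dvd_iff (h : Electing m v w c a b) (hw : IsCoprime w (m : ℤ)) (i : Fin n) :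
    (m : ℤ) ∣ (c.1 i).value ↔ (m : ℤ) ∣ a i := dvd_iff_dvd_weight hw (h.hand_weight i)

theorem Electing.room_dvd_iff (h : Electing m v w c a b) (hw : IsCoprime w (m : ℤ)) (j : Fin r) :
    (m : ℤ) ∣ (c.2 j).value v ↔ (m : ℤ) ∣ b j := dvd_iff_dvd_weight hw (h.room_weight j)

theorem Electing.sum_dvd_iff (h : Electing m v w c a b) (hw : IsCoprime w (m : ℤ)) (i : Fin n)
    (j : Fin r) : (m : ℤ) ∣ (c.1 i).value + (c.2 j).value v ↔ (m : ℤ) ∣ a i + b j := by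
  refine dvd_iff_dvd_weight hw ?_
  have := dvd_add (h.hand_weight i) (h.room_weight j)
  rwa [← add_sub_add_comm, ← mul_add] at this

theorem Electing.hand_weight_le (h : Electing m v w c a b) (i : Fin n) (j : Fin r) :
    a i + b j ≤ m := by
  have h1 := Finset.single_le_sum (f := a) (fun i _ => h.hand_nonneg i) (Finset.mem_univ i)
  have h2 := Finset.single_le_sum (f := b) (fun j _ => h.room_nonneg j) (Finset.mem_univ j)
  have := h.weight
  linarith

/-- If combining the amounts of a prisoner and a room does not produce a leader, then they do not
have the total weight. -/
theorem Electing.weight_lt (h : Electing m v w c a b) (hm : 1 < m) (hw : IsCoprime w (m : ℤ))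
    (hno : ¬ (¬ (m : ℤ) ∣ (c.1 i).value ∧ ¬ (m : ℤ) ∣ (c.2 j).value v ∧
      (m : ℤ) ∣ (c.1 i).value + (c.2 j).value v)) : a i + b j < m := by
  refine lt_of_le_of_ne (h.hand_weight_le i j) fun heq => hno ?_
  have h1 := h.hand_lt hm i
  have h2 := h.room_lt hm j
  rw [h.hand_dvd_iff hw, h.room_dvd_iff hw]
  refine ⟨fun hd => ?_, fun hd => ?_, ?_⟩
  · have := Int.le_of_dvd (by omega) hd
    omega
  · have := Int.le_of_dvd (by omega) hd
    omega
  · rw [h.sum_dvd_iff hw, heq]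

/-- When a leader is elected, the two amounts combined have the total weight, so that all other
amounts have weight `0`. -/
theorem Electing.elected (h : Electing m v w c a b) (hn : 0 < n) (hm : 0 < m)
    (hw : IsCoprime w (m : ℤ)) (h1 : m = 1 → n = 1 ∨ r = 1)
    (hlead : m = 1 ∨ (¬ (m : ℤ) ∣ (c.1 i).value ∧ ¬ (m : ℤ) ∣ (c.2 j).value v ∧
      (m : ℤ) ∣ (c.1 i).value + (c.2 j).value v)) :
    Posting m v (Function.update c.1 i (.post 0 0), Function.update c.2 j (.val 0)) V i 0 0 := by
  have hothers : (∀ i', i' ≠ i → (m : ℤ) ∣ (c.1 i').value) ∧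
      ∀ j', j' ≠ j → (m : ℤ) ∣ (c.2 j').value v := by
    rcases hlead with rfl | ⟨hh, hx, hs⟩
    · simp
    · have hm' : 1 < m := by
        by_contra h'
        have : m = 1 := by omega
        exact hh (by simp [this])
      rw [h.sum_dvd_iff hw] at hs
      rw [h.hand_dvd_iff hw] at hh
      have ha := h.hand_nonneg i
      have hb := h.room_nonneg j
      have ha' : a i ≠ 0 := fun h0 => hh (by simp [h0])
      have hle := Int.le_of_dvd (by omega) hs
      have e1 := Finset.add_sum_erase Finset.univ a (Finset.mem_univ i)
      have e2 := Finset.add_sum_erase Finset.univ b (Finset.mem_univ j)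
      have p1 := Finset.sum_nonneg (s := Finset.univ.erase i) fun i _ => h.hand_nonneg i
      have p2 := Finset.sum_nonneg (s := Finset.univ.erase j) fun j _ => h.room_nonneg j
      have ht := h.weight
      have z1 : ∑ i ∈ Finset.univ.erase i, a i = 0 := by linarith
      have z2 : ∑ j ∈ Finset.univ.erase j, b j = 0 := by linarith
      rw [Finset.sum_eq_zero_iff_of_nonneg fun i _ => h.hand_nonneg i] at z1
      rw [Finset.sum_eq_zero_iff_of_nonneg fun j _ => h.room_nonneg j] at z2
      refine ⟨fun i' hi' => ?_, fun j' hj' => ?_⟩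
      · rw [h.hand_dvd_iff hw, z1 i' (by simp [hi'])]
        exact dvd_zero _
      · rw [h.room_dvd_iff hw, z2 j' (by simp [hj'])]
        exact dvd_zero _
  have hmark : ∀ j', ¬ (Function.update c.2 j (.val 0) j').Marked := by
    intro j'
    by_cases hj : j' = j
    · subst hj; simp [RoomState.Marked]
    · rw [Function.update_of_ne hj]
      rcases h.rooms j' with h' | ⟨x, -, h'⟩ <;> simp [h', RoomState.Marked]
  have hhand : ∀ i', (∃ g, Function.update c.1 i (.post 0 0) i' = .elect g) ∨
      Function.update c.1 i (.post 0 0) i' = .post 0 0 := by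
    intro i'
    by_cases hi : i' = i
    · subst hi; simp
    · simpa [hi] using Or.inl (h.hands i')
  exact {
    others := fun i' hi' => by
      obtain ⟨g, hg⟩ := h.hands i'
      have := hothers.1 i' hi'
      rw [hg] at this
      exact Or.inl ⟨g, by simpa [hi'] using hg, this⟩
    rooms := fun j' => by
      by_cases hj : j' = j
      · subst hj; simp [RoomState.value]
      · simpa [hj] using hothers.2 j' hj
    unique := fun hm1 i' g j' hi' _ => by
      rcases h1 hm1 with rfl | rfl
      · exact (hi' (Subsingleton.elim _ _)).elim
      · rw [Subsingleton.elim j' j]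
        simp
    visited := fun j' hj' => (hmark j' hj').elim
    leader := by simp
    k_lt := j.pos
    d_lt := hn
    ready := by
      refine Finset.sum_eq_zero fun j' _ => RoomState.readyCount_of_ne fun hr => ?_
      exact hmark j' (by simp only at hr; rw [hr]; trivial)
    token := fun j' ht => hmark j' (by simp only at ht; rw [ht]; trivial)
    veterans := fun i' e he => by
      rcases hhand i' with ⟨g, hg⟩ | hg <;> simp only [hg] at he <;> cases he
    tours := by
      refine Finset.sum_eq_zero fun i' _ => ?_
      rcases hhand i' with ⟨g, hg⟩ | hg <;> simp only [hg] <;> rfl }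

theorem Electing.visit (h : Electing m v w c a b) (hn : 0 < n) (hm : 0 < m)
    (hw : IsCoprime w (m : ℤ)) (h1 : m = 1 → n = 1 ∨ r = 1) (hVj : V' i j) :
    (∃ a' b', Electing m v w ((electionMachine n r m u v).visit c i j) a' b') ∨
      AfterElection m v ((electionMachine n r m u v).visit c i j) V' := by
  have lead : (m = 1 ∨ (¬ (m : ℤ) ∣ (c.1 i).value ∧ ¬ (m : ℤ) ∣ (c.2 j).value v ∧
      (m : ℤ) ∣ (c.1 i).value + (c.2 j).value v)) →
      AfterElection m v (Function.update c.1 i (postStep n r 0 0).1,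
        Function.update c.2 j (postStep n r 0 0).2) V' := by
    intro hl
    have := (h.elected (V := V') hn hm hw h1 hl).postStep (fun _ _ h => h) hVj (by simp)
    simpa using this
  obtain ⟨g, hg⟩ := h.hands i
  have hgv : (c.1 i).value = g := by rw [hg]; rfl
  have hα := h.hand_nonneg i
  have hβ := h.room_nonneg j
  have hαβ := dvd_add (h.hand_weight i) (h.room_weight j)
  rw [← add_sub_add_comm, ← mul_add] at hαβ
  rw [visit_electionMachine]
  rcases h.rooms j with hj | ⟨x, hx, hj⟩
  · have hjv : (c.2 j).value v = v := by rw [hj]; rfl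
    rw [hgv, hjv] at lead hαβ
    rw [hg, hj, electionStep]
    split_ifs with hl
    · exact Or.inr (lead hl)
    · have hm1 : 1 < m := by omega
      have hlt := h.weight_lt (i := i) (j := j) hm1 hw (by
        rw [hgv, hjv]; exact fun h' => hl (Or.inr h'))
      exact Or.inl ⟨_, _, h.update hm1 (α := a i + b j) (β := 0) le_rfl (by rw [hgv, hjv]; ring)
        (by omega) le_rfl (by ring) hlt (by omega) hαβ (by simp)⟩
  · have hjv : (c.2 j).value v = x := by rw [hj]; rfl
    have hm1 : 1 < m := by
      by_contra h'
      have := h.fresh (by omega) j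
      rw [hj] at this
      cases this
    rw [hgv, hjv] at lead hαβ
    have hga := h.hand_weight i
    have hxb := h.room_weight j
    rw [hgv] at hga
    rw [hjv] at hxb
    rw [hg, hj, electionStep]
    split_ifs with hpos hx0 hl
    · refine Or.inl ⟨_, _, h.update hm1 (α := a i) (β := b j) (by omega) ?_ hα hβ rfl
        (h.hand_lt hm1 i) (h.room_lt hm1 j) ?_ ?_⟩
      · rw [hgv, hjv, hx0]; ring
      · rw [sub_right_comm]
        exact dvd_sub_self_right.2 hga
      · rw [hx0] at hxb
        rw [zero_sub] at hxb
        exact dvd_add (dvd_refl _) hxb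
    · exact Or.inl ⟨_, _, h.update hm1 (α := a i) (β := b j) hx (by rw [hgv, hjv]) hα hβ rfl
        (h.hand_lt hm1 i) (h.room_lt hm1 j) hga hxb⟩
    · exact Or.inr (lead (Or.inr hl))
    · have hlt := h.weight_lt (i := i) (j := j) hm1 hw (by rwa [hgv, hjv])
      rcases le_total (g + x) 0 with hs | hs
      · rw [min_eq_left hs, max_eq_right hs]
        exact Or.inl ⟨_, _, h.update hm1 (α := a i + b j) (β := 0) le_rfl
          (by rw [hgv, hjv]; ring) (by omega) le_rfl (by ring) hlt (by omega)
          hαβ (by simp)⟩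
      · rw [min_eq_right hs, max_eq_left hs]
        exact Or.inl ⟨_, _, h.update hm1 (α := 0) (β := a i + b j) hs
          (by rw [hgv, hjv]; ring) le_rfl (by omega) (by ring) (by omega) hlt
          (by simp) hαβ⟩

/-- The election does not get stuck: otherwise all amounts would have the same sign, hence vanish,
and so would all weights. -/
theorem Electing.not_stuck (h : Electing m v w c a b) (hn : 0 < n) (hr : 0 < r) (hm : 0 < m)
    (hw : IsCoprime w (m : ℤ))
    (hs : ∀ i j, electionStep n r m v (c.1 i) (c.2 j) = (c.1 i, c.2 j)) : False := by
  have hpost : ∀ g, (postStep n r 0 0).1 ≠ .elect g := by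
    intro g
    unfold postStep
    split_ifs <;> simp
  have hval : ∀ j, ∃ x, 0 ≤ x ∧ c.2 j = .val x := by
    intro j
    rcases h.rooms j with hj | hj
    · obtain ⟨g, hg⟩ := h.hands ⟨0, hn⟩
      have h1 := hs ⟨0, hn⟩ j
      rw [hg, hj, electionStep] at h1
      split_ifs at h1
      · exact (hpost _ (congrArg Prod.fst h1)).elim
      · simp at h1
    · exact hj
  have hm1 : 1 < m := by
    by_contra h'
    obtain ⟨x, -, hx⟩ := hval ⟨0, hr⟩
    have := h.fresh (by omega) ⟨0, hr⟩
    rw [hx] at this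
    cases this
  -- Prisoners in debt face empty rooms only, and prisoners in credit face no empty room.
  have key : ∀ i j, ((c.1 i).value < 0 → (c.2 j).value v = 0) ∧
      (0 < (c.1 i).value → 0 < (c.2 j).value v) := by
    intro i j
    obtain ⟨g, hg⟩ := h.hands i
    obtain ⟨x, hx, hj⟩ := hval j
    have h1 := hs i j
    rw [hg, hj, electionStep] at h1
    rw [hg, hj]
    simp only [Memory.value, RoomState.value]
    split_ifs at h1 with hpos hx0 hl
    · simp only [Prod.mk.injEq, Memory.elect.injEq] at h1
      omega
    · omega
    · exact (hpost _ (congrArg Prod.fst h1)).elim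
    · simp only [Prod.mk.injEq, Memory.elect.injEq, RoomState.val.injEq] at h1
      omega
  have hroom : ∀ j, 0 ≤ (c.2 j).value v := by
    intro j
    obtain ⟨x, hx, hj⟩ := hval j
    rw [hj]
    exact hx
  have hhand : ∀ i, 0 ≤ (c.1 i).value := by
    intro i
    by_contra hneg
    push Not at hneg
    have hz : ∀ j, (c.2 j).value v = 0 := fun j => (key i j).1 hneg
    have hle : ∀ i', (c.1 i').value ≤ 0 := by
      intro i'
      by_contra hpos
      push Not at hpos
      have := (key i' ⟨0, hr⟩).2 hpos
      rw [hz] at this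
      omega
    have ht := h.total
    rw [Finset.sum_eq_zero fun j _ => hz j, add_zero] at ht
    have := Finset.sum_lt_sum (fun i _ => hle i) ⟨i, Finset.mem_univ i, hneg⟩
    rw [ht] at this
    simp at this
  have s1 := Finset.sum_nonneg (s := Finset.univ) fun i _ => hhand i
  have s2 := Finset.sum_nonneg (s := Finset.univ) fun j _ => hroom j
  have ht := h.total
  have z1 : ∑ i, (c.1 i).value = 0 := by linarith
  have z2 : ∑ j, (c.2 j).value v = 0 := by linarith
  rw [Finset.sum_eq_zero_iff_of_nonneg fun i _ => hhand i] at z1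
  rw [Finset.sum_eq_zero_iff_of_nonneg fun j _ => hroom j] at z2
  have hz : ∀ y : ℤ, 0 ≤ y → y < m → (m : ℤ) ∣ y → y = 0 := fun y h0 hlt hd =>
    Int.eq_zero_of_dvd_of_nonneg_of_lt h0 hlt hd
  have ha : ∀ i, a i = 0 := fun i => hz _ (h.hand_nonneg i) (h.hand_lt hm1 i)
    ((h.hand_dvd_iff hw i).1 (by rw [z1 i (Finset.mem_univ i)]; exact dvd_zero _))
  have hb : ∀ j, b j = 0 := fun j => hz _ (h.room_nonneg j) (h.room_lt hm1 j)
    ((h.room_dvd_iff hw j).1 (by rw [z2 j (Finset.mem_univ j)]; exact dvd_zero _))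
  have hweight := h.weight
  rw [Finset.sum_eq_zero fun i _ => ha i, Finset.sum_eq_zero fun j _ => hb j] at hweight
  omega

end Electing

/-! ### Correctness and the numbers of states -/

/-- The protocol wins when the initial amounts `u` of the prisoners and `v` of the rooms cancel
out and are, modulo `m`, the `w`-fold of weights `α`, `β` with total `m`, where `w` is coprime
to `m`. -/
theorem electionMachine_wins {n r m : ℕ} {u v w : ℤ} (hn : 0 < n) (hr : 0 < r) (hm : 0 < m)
    (hw : IsCoprime w (m : ℤ)) (h0 : n * u + r * v = 0) (α β : ℕ) (hα : α ≤ 1) (hβ : β ≤ 1)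
    (hu : (m : ℤ) ∣ u - w * α) (hv : (m : ℤ) ∣ v - w * β) (hαβ : n * α + r * β = m) :
    (electionMachine n r m u v).Wins n r := by
  have h1 : m = 1 → n = 1 ∨ r = 1 := by
    rintro rfl
    interval_cases α <;> interval_cases β <;> omega
  intro s hs
  have inv : ∀ t, (∃ a b, Electing m v w ((electionMachine n r m u v).trace s t) a b) ∨
      AfterElection m v ((electionMachine n r m u v).trace s t)
        fun i j => ∃ k, k < t ∧ s k = (i, j) := by
    intro t
    induction t with
    | zero =>
      refine Or.inl ⟨fun _ => α, fun _ => β, ?_⟩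
      exact {
        hands := fun _ => ⟨u, rfl⟩
        rooms := fun _ => Or.inl rfl
        total := by simpa [Machine.trace, electionMachine, Memory.value, RoomState.value] using h0
        hand_weight := fun _ => hu
        room_weight := fun _ => hv
        hand_nonneg := fun _ => by omega
        room_nonneg := fun _ => by omega
        weight := by simpa using mod_cast hαβ
        hand_lt := fun _ _ => by omega
        room_lt := fun _ _ => by omega
        fresh := fun _ _ => rfl }
    | succ t ih =>
      rcases ih with ⟨a, b, h⟩ | h
      · rcases h.visit (u := u) (i := (s t).1) (j := (s t).2)
          (V' := fun i j => ∃ k, k < t + 1 ∧ s k = (i, j)) hn hm hw h1 ⟨t, by omega, rfl⟩ with h | h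
        exacts [Or.inl h, Or.inr h]
      · exact Or.inr (h.visit (fun i j ⟨k, hk, hs⟩ => ⟨k, by omega, hs⟩) ⟨t, by omega, rfl⟩)
  refine ⟨?_, fun t ht i j => ?_⟩
  · obtain ⟨T, hT⟩ := exists_stuck (u := u) (v := v) hn hr hm s hs
    obtain ⟨l, hl⟩ : ∃ l, ((electionMachine n r m u v).trace s T).1 l = .done := by
      rcases inv T with ⟨a, b, h⟩ | h
      · exact (h.not_stuck hn hr hm hw hT).elim
      · exact (h.finished_of_stuck hT).1
    have hdone : ∀ k, ((electionMachine n r m u v).trace s (T + k)).1 l = .done := by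
      intro k
      induction k with
      | zero => exact hl
      | succ k ih =>
        rw [← add_assoc, Machine.trace, visit_electionMachine]
        by_cases hi : l = (s (T + k)).1
        · simp [← hi, ih, electionStep]
        · simpa [hi] using ih
    obtain ⟨t, ht, hst⟩ := hs l ⟨0, hr⟩ T
    obtain ⟨k, rfl⟩ := Nat.exists_eq_add_of_le ht
    refine ⟨T + k, ?_⟩
    rw [hst]
    exact hdone (k + 1)
  · have hdone : ((electionMachine n r m u v).trace s (t + 1)).1 (s t).1 = .done := ht
    have visited : ∀ i j, ∃ k, k < t + 1 ∧ s k = (i, j) := by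
      rcases inv (t + 1) with ⟨a, b, h⟩ | ⟨l, d, k, h⟩ | ⟨l, d, h⟩ | ⟨l, d, k, e, p, h⟩ | h
      · obtain ⟨g, hg⟩ := h.hands (s t).1
        rw [hdone] at hg
        cases hg
      case inr.inr.inr.inr => exact h.2
      all_goals
        by_cases hi : (s t).1 = l
        · have := h.leader
          rw [← hi, hdone] at this
          cases this
        · rcases h.others _ hi with ⟨g, hg, -⟩ | ⟨e, hg⟩ <;>
          · rw [hdone] at hg
            cases hg
    obtain ⟨k, hk, h⟩ := visited i j
    exact ⟨k, by omega, h⟩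

theorem hasSymmetricWinningStrategy_of_wins {n r m q : ℕ} {u v : ℤ} (hr : 0 < r) (hm : 0 < m)
    (h : (electionMachine n r m u v).Wins n r) (init : Fin r → Fin q)
    (hq : stateBound r m + (Finset.univ.image init).card ≤ q + 1) :
    HasSymmetricWinningStrategy n r q init :=
  h.hasSymmetricWinningStrategy hr (RoomState.Good r m) trivial (good_electionStep hm v)
    RoomState.code (stateBound r m) RoomState.code_injOn (fun _ => RoomState.code_lt) rfl init hq

/-- All weight is with the prisoners, and amounts matter modulo their number. -/
theorem electionMachine_wins_mod_prisoners {n r : ℕ} (hn : 0 < n) (hr : 0 < r)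
    (h : Nat.gcd n r = 1) :
    (electionMachine n r n r (-n)).Wins n r :=
  electionMachine_wins (w := r) hn hr hn (Nat.isCoprime_iff_coprime.2 (Nat.Coprime.symm h))
    (by ring) 1 0 le_rfl (by omega) (by simp) (by simp) (by simp)

/-- All weight is with the rooms, and amounts matter modulo their number. -/
theorem electionMachine_wins_mod_rooms {n r : ℕ} (hn : 0 < n) (hr : 0 < r)
    (h : Nat.gcd n r = 1) :
    (electionMachine n r r (-r) n).Wins n r :=
  electionMachine_wins (w := n) hn hr hr (Nat.isCoprime_iff_coprime.2 h)
    (by ring) 0 1 (by omega) le_rfl (by simp) (by simp) (by simp)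

theorem stateBound_le (r m : ℕ) (hm : 0 < m) : stateBound r m ≤ m + 6 := by
  unfold stateBound
  split_ifs <;> omega

theorem card_image_allZero_le (r : ℕ) {q : ℕ} (hq : 0 < q) :
    (Finset.univ.image (allZero r hq)).card ≤ 1 :=
  Finset.card_le_one.2 fun x hx y hy => by
    simp only [allZero, Finset.mem_image, Finset.mem_univ, true_and] at hx hy
    obtain ⟨_, rfl⟩ := hx
    obtain ⟨_, rfl⟩ := hy
    rfl

theorem hasSymmetricWinningStrategy_of_min {n r q : ℕ} (hn : 0 < n) (hr : 0 < r)
    (h : Nat.gcd n r = 1) (init : Fin r → Fin q)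
    (hq : min n r + 6 + (Finset.univ.image init).card ≤ q + 1) :
    HasSymmetricWinningStrategy n r q init := by
  rcases le_total n r with hle | hle
  · have := stateBound_le r n hn
    exact hasSymmetricWinningStrategy_of_wins hr hn
      (electionMachine_wins_mod_prisoners hn hr h) init (by omega)
  · have := stateBound_le r r hr
    exact hasSymmetricWinningStrategy_of_wins hr hr
      (electionMachine_wins_mod_rooms hn hr h) init (by omega)

theorem theorem2 :
    -- from all rooms in state 0, a symmetric winning strategy for some `q` iff coprime
    (∀ n r : ℕ, 0 < n → 0 < r →
      ((∃ (q : ℕ) (hq : 0 < q), HasSymmetricWinningStrategy n r q (allZero r hq)) ↔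
        Nat.gcd n r = 1)) ∧
    -- the number of states needed is bounded in terms of `min n r`; for an arbitrary known
    -- initial configuration, at most `r - 1` further states are needed
    (∃ f : ℕ → ℕ, ∀ n r : ℕ, 0 < n → 0 < r → Nat.gcd n r = 1 →
      (∀ (q : ℕ) (hq : 0 < q), f (min n r) ≤ q →
        HasSymmetricWinningStrategy n r q (allZero r hq)) ∧
      (∀ q : ℕ, f (min n r) + (r - 1) ≤ q → ∀ init : Fin r → Fin q,
        HasSymmetricWinningStrategy n r q init)) ∧
    -- explicit numbers of states
    (∀ n r : ℕ, 0 < n → n < r → Nat.gcd n r = 1 →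
      ∀ (q : ℕ) (hq : 0 < q), 2 * n + 4 ≤ q →
        HasSymmetricWinningStrategy n r q (allZero r hq)) ∧
    (∀ n r : ℕ, 0 < r → r < n → Nat.gcd n r = 1 →
      ∀ (q : ℕ) (hq : 0 < q), 8 * r - 4 ≤ q →
        HasSymmetricWinningStrategy n r q (allZero r hq)) := by
  refine ⟨fun n r hn hr => ⟨?_, fun h => ?_⟩, ⟨(· + 6), fun n r hn hr h => ⟨?_, ?_⟩⟩, ?_, ?_⟩
  · rintro ⟨q, hq, h⟩
    exact gcd_eq_one_of_hasSymmetricWinningStrategy hn hr _ h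
  · have h0 : 0 < min n r + 6 := by omega
    have := card_image_allZero_le r h0
    exact ⟨min n r + 6, h0, hasSymmetricWinningStrategy_of_min hn hr h _ (by omega)⟩
  · intro q hq hq'
    dsimp only at hq'
    have := card_image_allZero_le r hq
    exact hasSymmetricWinningStrategy_of_min hn hr h _ (by omega)
  · intro q hq init
    dsimp only at hq
    have : (Finset.univ.image init).card ≤ r := Finset.card_image_le.trans (by simp)
    exact hasSymmetricWinningStrategy_of_min hn hr h _ (by omega)
  · intro n r hn hnr h q hq hq'
    have := card_image_allZero_le r hq
    refine hasSymmetricWinningStrategy_of_wins (by omega) hn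
      (electionMachine_wins_mod_prisoners hn (by omega) h) _ ?_
    have : stateBound r n ≤ 2 * n + 4 := by
      unfold stateBound
      split_ifs <;> omega
    omega
  · intro n r hr hrn h q hq hq'
    have := card_image_allZero_le r hq
    refine hasSymmetricWinningStrategy_of_wins hr hr
      (electionMachine_wins_mod_rooms (by omega) hr h) _ ?_
    have : stateBound r r ≤ 8 * r - 4 := by
      unfold stateBound
      split_ifs <;> omega
    omega
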